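/- Let $p$ be an odd prime, $m$ an even positive integer, $n=2m$, $Q=p^{m/2}$, let $\mathbb M$ be the field with $p^m=Q^2$ elements and $\mathbb L=\{x\in\mathbb M: x^Q=x\}$ its subfield with $Q$ elements. For $q=p^k$ with $1\le k\le m-1$ and $m/\gcd(k,m)$ odd, a non-square $B\in\mathbb M$, and $a\in\mathbb L^\times$, let $\mathbb P_{q,B,a}=(\mathbb M\times\mathbb M,+,\ast)$ be the commutative pre-semifield with $X\ast Y=F(X+Y)-F(X)-F(Y)$, where $$F(x,y)=\Bigl(x^{q+1}+B\,y^{q+1},\ x^{qQ}y+\frac aB\,x\,y^{qQ}\Bigr).$$ These pre-semifields form the family $\mathcal S$ over $\mathbb M$. Put $\overline q=p^{m-k}$. An isotopism from $(\mathbb M\times\mathbb M,+,\ast_1)$ to $(\mathbb M\times\mathbb M,+,\ast_2)$ is a triple $(N,L,K)$ of $\mathbb F_p$-linear bijections of $\mathbb M\times\mathbb M$ with $N(X\ast_1Y)=L(X)\ast_2K(Y)$ for all $X,Y$; it is strong if $L=K$; the two pre-semifields are (strongly) isotopic if a (strong) isotopism exists. Let $\mathbb P_{q,B,a}$ and $\mathbb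 P_{q',B',a'}$ range over $\mathcal S$. Then: 1. $\mathbb P_{q,B,a}$ and $\mathbb P_{q',B',a'}$ are isotopic if and only if they are strongly isotopic. 2. $\mathbb P_{\overline q,B,B^{Q+1}/a}$ belongs to $\mathcal S$ and $\mathbb P_{q,B,a}$ is isotopic to it. 3. For all $q,B,a$ and every non-square $B'\in\mathbb M$ there is $a'\in\mathbb L^\times$ such that $\mathbb P_{q,B,a}$ is isotopic to $\mathbb P_{q,B',a'}$. 4. If $\mathbb P_{q,B,a}$ is isotopic to $\mathbb P_{q,B,a'}$, then it is also isotopic to $\mathbb P_{q,B,-a'}$ (which again belongs to $\mathcal S$). 5. For given $q,B,a$ there are at most $2m=n$ elements $a'\in\mathbb L^\times$ such that $\mathbb P_{q,B,a}$ is isotopic to $\mathbb P_{q,B,a'}$. 6. There are no further isotopies: if $\mathbb P_{q,B,a}$ is isotopic to $\mathbb P_{q',B',a'}$, then $q'\in\{q,\overline q\}$. If $q'=q$, the isotopy is realized by a strong isotopism $(N,L,L)$ for which there are $0\le t<m$ and nonzero coefficients in $\mathbb M$ with $N(x,y)=(a_1x^{p^t},d_1y^{p^t})$ and either $L(x,y)=(a_2x^{p^t},d_2y^{p^t})$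 or $L(x,y)=(b_2y^{p^t},c_2x^{p^t})$. If $q'=\overline q$, there is a strong isotopism of this form from $\mathbb P_{q,B,a}$ to $\mathbb P_{q,B',B'^{Q+1}/a'}$, which is isotopic to $\mathbb P_{q',B',a'}$ by part 2. -/

import Mathlib

/-- The `q`-biprojective polynomial `(a, b, c, d)_q`, i.e. the function
`a x^(q+1) + b x^q y + c x y^q + d y^(q+1)` on `M × M`. -/
def biprojective {M : Type*} [Field M] (q : ℕ) (a b c d : M) (z : M × M) : M :=
  a * z.1 ^ (q + 1) + b * z.1 ^ q * z.2 + c * z.1 * z.2 ^ q + d * z.2 ^ (q + 1)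

/-- The polarization `(X, Y) ↦ F (X + Y) - F X - F Y` of a mapping `F`. -/
def polarization {V : Type*} [AddCommGroup V] (F : V → V) (X Y : V) : V :=
  F (X + Y) - F X - F Y

/-- `M` is a field with `p ^ m` elements, `q = p ^ k` and `r = p ^ (k + m / 2)`. The mapping
`[(1, 0, 0, B)_q, (0, 1, a / B, 0)_r]` of `M × M`. -/
def familyMap {M : Type*} [Field M] (p m k : ℕ) (B a : M) (z : M × M) : M × M :=
  (biprojective (p ^ k) 1 0 0 B z, biprojective (p ^ (k + m / 2)) 0 1 (a / B) 0 z)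

/-- The multiplication of `P_{q,B,a}` on `M × M`, where `q = p ^ k`. -/
def familyMul {M : Type*} [Field M] (p m k : ℕ) (B a : M) : M × M → M × M → M × M :=
  polarization (familyMap p m k B a)

/-- The conditions under which `P_{q,B,a}`, with `q = p ^ k`, belongs to the family `S` over the
field `M` with `p ^ m` elements: `1 ≤ k ≤ m - 1`, `m` is even, `m / gcd(k, m)` is odd, `B` is a
non-square of `M`, and `a` is a nonzero element of the subfield `L` with `Q = p ^ (m / 2)`
elements, `L = {x | x ^ Q = x}`. -/
structure InFamily {M : Type*} [Field M] (p m k : ℕ) (B a : M) : Prop where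
  one_le : 1 ≤ k
  lt : k < m
  even : Even m
  odd : Odd (m / Nat.gcd k m)
  nonsquare : ¬ IsSquare B
  ne_zero : a ≠ 0
  mem_subfield : a ^ (p ^ (m / 2)) = a

/-- `(N, L, K)` is an isotopism from the multiplication `mul₁` to the multiplication `mul₂`. -/
def IsIsotopism (p : ℕ) {V : Type*} [AddCommGroup V] [Module (ZMod p) V]
    (mul₁ mul₂ : V → V → V) (N L K : V ≃ₗ[ZMod p] V) : Prop :=
  ∀ X Y : V, N (mul₁ X Y) = mul₂ (L X) (K Y)

def Isotopic (p : ℕ) {V : Type*} [AddCommGroup V] [Module (ZMod p) V]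
    (mul₁ mul₂ : V → V → V) : Prop :=
  ∃ N L K : V ≃ₗ[ZMod p] V, IsIsotopism p mul₁ mul₂ N L K

def StronglyIsotopic (p : ℕ) {V : Type*} [AddCommGroup V] [Module (ZMod p) V]
    (mul₁ mul₂ : V → V → V) : Prop :=
  ∃ N L : V ≃ₗ[ZMod p] V, IsIsotopism p mul₁ mul₂ N L L

/-- There is a strong isotopism `(N, L, L)` in which `N` is
`(x, y) ↦ (a₁ x^(p^t), d₁ y^(p^t))`, and `L` is either `(x, y) ↦ (a₂ x^(p^t), d₂ y^(p^t))` or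
`(x, y) ↦ (b₂ y^(p^t), c₂ x^(p^t))`, for one and the same `0 ≤ t < m`. The coefficients are
nonzero because `N` and `L` are bijective. -/
def MonomiallyIsotopic (p m : ℕ) {M : Type*} [Field M] [Algebra (ZMod p) M]
    (mul₁ mul₂ : M × M → M × M → M × M) : Prop :=
  ∃ N L : (M × M) ≃ₗ[ZMod p] (M × M), IsIsotopism p mul₁ mul₂ N L L ∧
    ∃ t < m,
      (∃ a₁ d₁ : M, ∀ x y : M, N (x, y) = (a₁ * x ^ (p ^ t), d₁ * y ^ (p ^ t))) ∧
      ((∃ a₂ d₂ : M, ∀ x y : M, L (x, y) = (a₂ * x ^ (p ^ t), d₂ * y ^ (p ^ t))) ∨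
        (∃ b₂ c₂ : M, ∀ x y : M, L (x, y) = (b₂ * y ^ (p ^ t), c₂ * x ^ (p ^ t))))

/-! Every additive function M × M → M is a unique combination of the 2m monomials x^(p^i), y^(p^i),
with indices in ℤ/m (`coordBasis`). Let κ and η be the classes of k and m/2. As κ has odd order and
η has order two, few coincidences between shifts by κ and η are possible.

Let (N, L, K) be an isotopism, n the first component of N and q' = p^k' the parameter of the target.
The first component of the target product and its q'-th power share factors, so n(X∗Y) + x n(X∗Y)^q'
is a sum of only four products f(X)g(Y), for every x in M. The second component behaves alike with
q'Q. On the other hand, each nonzero coefficient of an additive function yields an invertible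
diagonal 4 × 4 block in the coefficient matrix of its composition with the product, and rank four
then determines all other entries (`RankLEFour.entry_eq`). So the indices of nonzero coefficients
differ only by a few shifts (`fst_support`, `snd_support`). The one configuration that survives the
comparison of single entries is excluded by B^(q(Q+1)) ≠ a^(q+1): the norm of B is a non-square of
𝕃, while a^(q+1) is a square there. Applied to the whole pencil in x, this gives k' ≡ ±k and N = (α
x^(p^t), β y^(p^s)).

Now L and K involve only the p^t-th powers of x and y, s = t, and their 2 × 2 matrices are both
diagonal or both antidiagonal (`column_eq_zero_or`). The remaining equations relate the parameters
through some w, up to a factor s = K/L fixed by κ (`WeakLink`). Since w^(q+1) = e² is solvable by a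
power of e (`exists_odd_exponent`), s can be absorbed into w, possibly at the cost of adding m/2 to
t; this makes the isotopism strong (`Link`). Antidiagonal matrices amount to inverting B' and a'.

The theorem is then read off from `Link`. For given t, B, B' it determines w up to sign and hence
a', so m values of t and two orientations leave at most 2m values. Adding m/2 to t changes the sign
of a'. The case k' = m − k is reduced to k' = k by an explicit isotopism. -/

/-- The `i`-th power of the Frobenius automorphism of a field with `p ^ m` elements. -/
def frob (p m : ℕ) {M : Type*} [Field M] [ExpChar M p] (i : ZMod m) : M →+* M :=
  iterateFrobenius M p i.val

theorem frob_def (p m : ℕ) {M : Type*} [Field M] [ExpChar M p] (i : ZMod m) (x : M) :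
    frob p m i x = x ^ p ^ i.val := rfl

/-! ### Powers of Frobenius with exponents in ℤ/m -/

section Frob

variable {p m : ℕ} {M : Type*} [Field M]

theorem frob_zero [ExpChar M p] [NeZero m] (x : M) : frob p m 0 x = x := by
  simp [frob_def]

theorem frob_eq_zero [ExpChar M p] {i : ZMod m} {x : M} : frob p m i x = 0 ↔ x = 0 := map_eq_zero _

variable [Finite M]

theorem pow_pow_mod (hM : Nat.card M = p ^ m) (x : M) (n : ℕ) :
    x ^ p ^ n = x ^ p ^ (n % m) := by
  have : Fintype M := Fintype.ofFinite M
  have h1 : ∀ (x : M) j, x ^ p ^ (m * j) = x := by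
    intro x j
    induction j generalizing x with
    | zero => simp
    | succ j ih =>
      rw [Nat.mul_succ, pow_add, pow_mul, ih, ← hM, Nat.card_eq_fintype_card,
        FiniteField.pow_card]
  conv_lhs => rw [← Nat.div_add_mod n m, pow_add, pow_mul, h1]

variable [ExpChar M p]

theorem pow_eq_frob [NeZero m] (hM : Nat.card M = p ^ m) (x : M) (n : ℕ) :
    x ^ p ^ n = frob p m (n : ZMod m) x := by
  rw [frob_def, ZMod.val_natCast, ← pow_pow_mod hM]

theorem frob_frob [NeZero m] (hM : Nat.card M = p ^ m) (i j : ZMod m) (x : M) :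
    frob p m i (frob p m j x) = frob p m (i + j) x := by
  rw [frob_def, frob_def, frob_def, ← pow_mul, ← pow_add, ZMod.val_add, ← pow_pow_mod hM, add_comm]

theorem frob_injective_index [NeZero m] (hp : 1 < p) (hM : Nat.card M = p ^ m) :
    Function.Injective fun i : ZMod m => ((frob p m i : M →+* M) : M →* M) := by
  have : Fintype M := Fintype.ofFinite M
  obtain ⟨g, hg⟩ := IsCyclic.exists_ofOrder_eq_natCard (α := Mˣ)
  have hc : Nat.card Mˣ = p ^ m - 1 := by
    rw [Nat.card_units, hM]
  intro i j hij
  have h : frob p m i (g : M) = frob p m j (g : M) := DFunLike.congr_fun hij (g : M)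
  have h2 : g ^ p ^ i.val = g ^ p ^ j.val := Units.ext (by simpa [frob_def] using h)
  rw [pow_inj_mod, hg, hc] at h2
  have key : ∀ a : ZMod m, p ^ a.val ≤ p ^ (m - 1) := fun a =>
    Nat.pow_le_pow_right (by omega) (by have := a.val_lt; omega)
  have hm : 0 < m := Nat.pos_of_ne_zero (NeZero.ne m)
  have hpm : p ^ m = p * p ^ (m - 1) := by
    rw [← pow_succ']; congr 1; omega
  have hpos : 0 < p ^ (m - 1) := by positivity
  -- The exponents p^i are known only modulo p^m - 1, so they have to lie below it; this can fail
  -- only for m = 1.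
  by_cases hsmall : p ^ (m - 1) < p ^ m - 1
  · rw [Nat.mod_eq_of_lt ((key i).trans_lt hsmall), Nat.mod_eq_of_lt ((key j).trans_lt hsmall)] at h2
    exact ZMod.val_injective m (Nat.pow_right_injective hp h2)
  · have h3 : p * p ^ (m - 1) ≤ p ^ (m - 1) + 1 := by omega
    have h4 : p ^ (m - 1) = 1 := by nlinarith
    have h5 : m - 1 = 0 := by
      rcases Nat.pow_eq_one.1 h4 with h | h <;> omega
    have h6 : m = 1 := by omega
    subst h6
    exact Subsingleton.elim _ _

end Frob

/-! ### Coordinates of additive functions on M × M -/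

section Coord

variable {p m : ℕ} [Fact p.Prime] {M : Type*} [Field M] [Algebra (ZMod p) M]

/-- The Frobenius automorphism as a linear map over the prime field. -/
def frobLin (p m : ℕ) [Fact p.Prime] {M : Type*} [Field M] [Algebra (ZMod p) M] [ExpChar M p]
    (i : ZMod m) : M →ₗ[ZMod p] M where
  toFun := frob p m i
  map_add' := map_add _
  map_smul' c x := by
    rw [Algebra.smul_def, map_mul, RingHom.id_apply, Algebra.smul_def]
    congr 1
    rw [frob_def, ← map_pow, ZMod.pow_card_pow]

@[simp]
theorem frobLin_apply [ExpChar M p] (i : ZMod m) (x : M) : frobLin p m i x = frob p m i x := rfl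

/-- The coordinate functions `(x, y) ↦ x ^ p ^ i` and `(x, y) ↦ y ^ p ^ i`. -/
def coord (p m : ℕ) [Fact p.Prime] {M : Type*} [Field M] [Algebra (ZMod p) M] [ExpChar M p] :
    ZMod m ⊕ ZMod m → (M × M →ₗ[ZMod p] M)
  | .inl i => frobLin p m i ∘ₗ LinearMap.fst (ZMod p) M M
  | .inr i => frobLin p m i ∘ₗ LinearMap.snd (ZMod p) M M

@[simp]
theorem coord_inl [ExpChar M p] (i : ZMod m) (X : M × M) :
    coord p m (.inl i) X = frob p m i X.1 := rfl

@[simp]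
theorem coord_inr [ExpChar M p] (i : ZMod m) (X : M × M) :
    coord p m (.inr i) X = frob p m i X.2 := rfl

variable [Finite M]

theorem linearIndependent_coord [ExpChar M p] [NeZero m] (hM : Nat.card M = p ^ m) :
    LinearIndependent M (coord p m (M := M)) := by
  have hinj := frob_injective_index (M := M) (Fact.out : p.Prime).one_lt hM
  have hli := (linearIndependent_monoidHom M M).comp _ hinj
  rw [Fintype.linearIndependent_iff] at hli ⊢
  intro c hc
  have e1 : ∀ X : M × M, ∑ i, c (.inl i) * frob p m i X.1 + ∑ i, c (.inr i) * frob p m i X.2 = 0 := by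
    intro X
    simpa [Fintype.sum_sum_type] using congrArg (fun f : M × M →ₗ[ZMod p] M => f X) hc
  have h1 := hli (fun i => c (.inl i)) (by
    ext x
    simpa using e1 (x, 0))
  have h2 := hli (fun i => c (.inr i)) (by
    ext x
    simpa using e1 (0, x))
  rintro (i | i)
  · exact h1 i
  · exact h2 i

theorem finrank_prod_linearMap [NeZero m] (hM : Nat.card M = p ^ m) :
    Module.finrank M (M × M →ₗ[ZMod p] M) = Fintype.card (ZMod m ⊕ ZMod m) := by
  have : Fintype M := Fintype.ofFinite M
  have h1 : Module.finrank (ZMod p) M = m := by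
    have h := Module.card_eq_pow_finrank (K := ZMod p) (V := M)
    rw [← Nat.card_eq_fintype_card, hM, ZMod.card] at h
    exact (Nat.pow_right_injective (Fact.out : p.Prime).two_le h).symm
  rw [Module.finrank_linearMap_self, Module.finrank_prod, h1, Fintype.card_sum, ZMod.card]

/-- The coordinate functions form a basis of the additive functions `M × M → M`. -/
noncomputable def coordBasis [ExpChar M p] [NeZero m] (hM : Nat.card M = p ^ m) :
    Module.Basis (ZMod m ⊕ ZMod m) M (M × M →ₗ[ZMod p] M) :=
  basisOfLinearIndependentOfCardEqFinrank (linearIndependent_coord hM)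
    (finrank_prod_linearMap hM).symm

@[simp]
theorem coordBasis_apply [ExpChar M p] [NeZero m] (hM : Nat.card M = p ^ m)
    (u : ZMod m ⊕ ZMod m) : coordBasis hM u = coord p m u := by
  simp [coordBasis]

theorem eq_sum_repr [ExpChar M p] [NeZero m] (hM : Nat.card M = p ^ m)
    (n : M × M →ₗ[ZMod p] M) (X : M × M) :
    n X = ∑ i, (coordBasis hM).repr n (.inl i) * frob p m i X.1 +
      ∑ i, (coordBasis hM).repr n (.inr i) * frob p m i X.2 := by
  conv_lhs => rw [← (coordBasis hM).sum_repr n]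
  simp [Fintype.sum_sum_type]

theorem repr_frob_comp [ExpChar M p] [NeZero m] (hM : Nat.card M = p ^ m)
    (n : M × M →ₗ[ZMod p] M) (d i : ZMod m) :
    (coordBasis hM).repr (frobLin p m d ∘ₗ n) (.inl i) =
        frob p m d ((coordBasis hM).repr n (.inl (i - d))) ∧
      (coordBasis hM).repr (frobLin p m d ∘ₗ n) (.inr i) =
        frob p m d ((coordBasis hM).repr n (.inr (i - d))) := by
  set b := coordBasis (M := M) (p := p) hM
  set c : ZMod m ⊕ ZMod m → M := Sum.elim (fun i => frob p m d (b.repr n (.inl (i - d))))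
    (fun i => frob p m d (b.repr n (.inr (i - d)))) with hc
  have : frobLin p m d ∘ₗ n = ∑ u, c u • b u := by
    ext1 <;> ext x
    · simp only [LinearMap.coe_comp, Function.comp_apply, LinearMap.inl_apply,
        LinearMap.sum_apply, LinearMap.smul_apply, frobLin_apply]
      simp [eq_sum_repr hM n, Fintype.sum_sum_type, b, hc, frob_frob hM]
      exact Fintype.sum_equiv (Equiv.addLeft d) _ _ fun i => by simp
    · simp only [LinearMap.coe_comp, Function.comp_apply, LinearMap.inr_apply,
        LinearMap.sum_apply, LinearMap.smul_apply, frobLin_apply]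
      simp [eq_sum_repr hM n, Fintype.sum_sum_type, b, hc, frob_frob hM]
      exact Fintype.sum_equiv (Equiv.addLeft d) _ _ fun i => by simp
  have h := fun u => congrFun (congrArg DFunLike.coe (congrArg b.repr this)) u
  rw [b.repr_sum_self] at h
  exact ⟨h _, h _⟩

end Coord

/-! ### Bilinear forms of rank at most four -/

section Rank

variable {K V ι : Type*} [Field K] [Fintype ι]

/-- Modulo `S` the sum vanishes; every linear functional of the quotient turns it into a relation
between the independent functions `e u`. -/
theorem mem_of_sum_smul_mem {W : Type*} [AddCommGroup W] [Module K W] {e : ι → V → K}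
    (he : LinearIndependent K e) (S : Submodule K W) (R : ι → W)
    (h : ∀ X, ∑ u, e u X • R u ∈ S) (u : ι) : R u ∈ S := by
  rw [← Submodule.Quotient.mk_eq_zero, ← Module.forall_dual_apply_eq_zero_iff K]
  intro f
  refine Fintype.linearIndependent_iff.1 he (fun u => f (S.mkQ (R u))) ?_ u
  ext X
  have h1 : f (S.mkQ (∑ u, e u X • R u)) = 0 := by
    rw [Submodule.mkQ_apply, (Submodule.Quotient.mk_eq_zero S).2 (h X), map_zero]
  simpa [map_sum, mul_comm] using h1

/-- `φ` is a sum of four products of a function of `X` and a function of `Y`. -/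
def RankLEFour (φ : V → V → K) : Prop :=
  ∃ l r : Fin 4 → V → K, ∀ X Y, φ X Y = ∑ j, l j X * r j Y

/-- If a bilinear form of rank at most four has an invertible diagonal `4 × 4` block, then all of
its other entries are determined by the rows and columns of that block. -/
theorem RankLEFour.entry_eq {e : ι → V → K} (he : LinearIndependent K e) {A : ι → ι → K}
    (hA : RankLEFour fun X Y => ∑ u, ∑ v, A u v * e u X * e v Y) {r c : Fin 4 → ι} {w : Fin 4 → K}
    (hw : ∀ j, w j ≠ 0) (hrc : ∀ i j, A (r i) (c j) = if i = j then w i else 0) (u v : ι) :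
    A u v = ∑ j, A u (c j) * A (r j) v / w j := by
  obtain ⟨l, g, hlg⟩ := hA
  set R : ι → V → K := fun u Y => ∑ v, A u v * e v Y with hR
  have inj : ∀ a : ι → K, (∀ Y, ∑ v, a v * e v Y = 0) → ∀ v, a v = 0 := fun a ha v =>
    Fintype.linearIndependent_iff.1 he a (by ext Y; simpa using ha Y) v
  have hmem : ∀ u, R u ∈ Submodule.span K (Set.range g) := by
    refine mem_of_sum_smul_mem he _ R fun X => ?_
    have : ∑ u, e u X • R u = ∑ j, l j X • g j := by
      ext Y
      have := hlg X Y
      simp only [Finset.sum_apply, Pi.smul_apply, smul_eq_mul, hR, Finset.mul_sum] at this ⊢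
      rw [← this]
      exact Finset.sum_congr rfl fun _ _ => Finset.sum_congr rfl fun _ _ => by ring
    rw [this]
    exact Submodule.sum_mem _ fun j _ => Submodule.smul_mem _ _ (Submodule.subset_span ⟨j, rfl⟩)
  have hli : LinearIndependent K fun j => R (r j) := by
    rw [Fintype.linearIndependent_iff]
    intro a ha j
    have h1 := inj (fun v => ∑ i, a i * A (r i) v) (fun Y => by
      have := congrFun ha Y
      simp only [Finset.sum_apply, Pi.smul_apply, smul_eq_mul, hR, Finset.mul_sum, Pi.zero_apply]
        at this
      rw [Finset.sum_comm] at this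
      rw [← this]
      refine Finset.sum_congr rfl fun _ _ => ?_
      rw [Finset.sum_mul]
      exact Finset.sum_congr rfl fun _ _ => by ring) (c j)
    simpa [hrc, hw j] using h1
  -- Four independent rows inside the span of four functions span it, so every row is a combination
  -- of them; its coefficients are read off in the columns `c j`.
  have hspan : Submodule.span K (Set.range fun j => R (r j)) = Submodule.span K (Set.range g) := by
    have : FiniteDimensional K (Submodule.span K (Set.range g)) :=
      FiniteDimensional.span_of_finite K (Set.finite_range g)
    refine Submodule.eq_of_le_of_finrank_le ?_ ?_
    · rw [Submodule.span_le]
      rintro _ ⟨j, rfl⟩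
      exact hmem _
    · rw [finrank_span_eq_card hli]
      exact finrank_range_le_card g
  have hu := hmem u
  rw [← hspan, Submodule.mem_span_range_iff_exists_fun] at hu
  obtain ⟨a, ha⟩ := hu
  have h2 : ∀ v, ∑ j, a j * A (r j) v = A u v := by
    intro v
    have h1 := inj (fun v => ∑ i, a i * A (r i) v - A u v) (fun Y => by
      have := congrFun ha Y
      simp only [Finset.sum_apply, Pi.smul_apply, smul_eq_mul, hR, Finset.mul_sum] at this
      rw [Finset.sum_comm] at this
      simp only [sub_mul, Finset.sum_sub_distrib, sub_eq_zero]
      rw [← this]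
      refine Finset.sum_congr rfl fun _ _ => ?_
      rw [Finset.sum_mul]
      exact Finset.sum_congr rfl fun _ _ => by ring) v
    exact sub_eq_zero.1 h1
  have h3 : ∀ j, a j = A u (c j) / w j := by
    intro j
    rw [eq_div_iff (hw j), ← h2 (c j)]
    simp [hrc]
  rw [← h2 v]
  exact Finset.sum_congr rfl fun j _ => by rw [h3]; ring

end Rank

/-! ### The product and its coefficient matrix -/

section Product

variable {p m : ℕ} {M : Type*} [Field M] [ExpChar M p]

/-- The first component of the multiplication, with `q` the `κ`-th power of Frobenius. -/
def mulFst (p : ℕ) {m : ℕ} {M : Type*} [Field M] [ExpChar M p] (κ : ZMod m) (B : M)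
    (X Y : M × M) : M :=
  frob p m κ X.1 * Y.1 + X.1 * frob p m κ Y.1 + B * (frob p m κ X.2 * Y.2 + X.2 * frob p m κ Y.2)

/-- The second component of the multiplication, with `r` the `ρ`-th power of Frobenius. -/
def mulSnd (p : ℕ) {m : ℕ} {M : Type*} [Field M] [ExpChar M p] (ρ : ZMod m) (c : M)
    (X Y : M × M) : M :=
  frob p m ρ X.1 * Y.2 + X.2 * frob p m ρ Y.1 + c * (X.1 * frob p m ρ Y.2 + frob p m ρ X.2 * Y.1)

theorem familyMul_eq [Finite M] [NeZero m] (hM : Nat.card M = p ^ m) (k : ℕ) (B a : M)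
    (X Y : M × M) : familyMul p m k B a X Y =
      (mulFst p (k : ZMod m) B X Y,
        mulSnd p ((k : ZMod m) + ((m / 2 : ℕ) : ZMod m)) (a / B) X Y) := by
  rw [← Nat.cast_add]
  simp only [familyMul, polarization, familyMap, biprojective, mulFst, mulSnd, ← pow_eq_frob hM]
  ext
  · simp only [Prod.fst_sub, Prod.fst_add, Prod.snd_add, pow_succ (_ + _) (p ^ _),
      add_pow_expChar_pow]
    ring
  · simp only [Prod.snd_sub, Prod.fst_add, Prod.snd_add, add_pow_expChar_pow]
    ring

/-- The coefficient matrix of `∑ i, α i * mulFst ^ p ^ i + ∑ i, β i * mulSnd ^ p ^ i` in the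
coordinates `coord`. -/
def productMatrix (p : ℕ) {m : ℕ} {M : Type*} [Field M] [ExpChar M p] (κ ρ : ZMod m) (B c : M)
    (α β : ZMod m → M) : ZMod m ⊕ ZMod m → ZMod m ⊕ ZMod m → M
  | .inl i, .inl j => (if j = i + κ then α i else 0) + if i = j + κ then α j else 0
  | .inr i, .inr j => (if j = i + κ then α i * frob p m i B else 0) +
      if i = j + κ then α j * frob p m j B else 0
  | .inl i, .inr j => (if i = j + ρ then β j else 0) + if j = i + ρ then β i * frob p m i c else 0
  | .inr j, .inl i => (if i = j + ρ then β j else 0) + if j = i + ρ then β i * frob p m i c else 0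

end Product

theorem sum_productMatrix {p m : ℕ} [Fact p.Prime] {M : Type*} [Field M] [Algebra (ZMod p) M]
    [Finite M] [ExpChar M p] [NeZero m] (hM : Nat.card M = p ^ m)
    (κ ρ : ZMod m) (B c : M) (α β : ZMod m → M) (X Y : M × M) :
    ∑ u, ∑ v, productMatrix p κ ρ B c α β u v * coord p m u X * coord p m v Y =
      ∑ i, α i * frob p m i (mulFst p κ B X Y) + ∑ i, β i * frob p m i (mulSnd p ρ c X Y) := by
  have s1 : ∀ (d : ZMod m) (γ : ZMod m → M) (x y : M),
      ∑ i, ∑ j, (if j = i + d then γ i else 0) * frob p m i x * frob p m j y =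
        ∑ i, γ i * frob p m i (x * frob p m d y) := fun d γ x y => by
    simp only [ite_mul, zero_mul, Finset.sum_ite_eq', Finset.mem_univ, if_true, map_mul,
      frob_frob hM, mul_assoc]
  have s2 : ∀ (d : ZMod m) (γ : ZMod m → M) (x y : M),
      ∑ i, ∑ j, (if i = j + d then γ j else 0) * frob p m i x * frob p m j y =
        ∑ i, γ i * frob p m i (frob p m d x * y) := fun d γ x y => by
    rw [Finset.sum_comm]
    simp only [ite_mul, zero_mul, Finset.sum_ite_eq', Finset.mem_univ, if_true, map_mul,
      frob_frob hM, mul_assoc]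
  simp only [Fintype.sum_sum_type, productMatrix, coord_inl, coord_inr, add_mul,
    Finset.sum_add_distrib]
  simp only [s1, s2 _ _ X.1 Y.1, s2 _ (fun i => α i * frob p m i B), s2 ρ β, s2 ρ (fun i => β i * frob p m i c)]
  simp only [mulFst, mulSnd, map_add, map_mul, mul_add, Finset.sum_add_distrib]
  simp only [mul_assoc, mul_left_comm]
  ring

/-- The relations between the shifts `κ` (of odd order) and `η` (of order two). -/
structure ShiftFacts {m : ℕ} (κ η : ZMod m) : Prop where
  kappa_ne : κ ≠ 0
  two_ne : 2 * κ ≠ 0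
  four_ne : 4 * κ ≠ 0
  eta_add : η + η = 0
  eta_ne : η ≠ 0
  ne_eta : κ ≠ η
  two_ne_eta : 2 * κ ≠ η
  three_ne_eta : 3 * κ ≠ η
  four_ne_eta : 4 * κ ≠ η

/-! ### Rank four restricts the support of the coefficients -/

section Support

variable {p m : ℕ} {M : Type*} [Field M] [ExpChar M p]

/-- The block that belongs to a nonzero `α i`. The columns are the rows with each pair exchanged, so
that the nonzero entries come to lie on the diagonal. -/
theorem productMatrix_edge_fst {κ η : ZMod m} (hS : ShiftFacts κ η) (B c : M)
    (α β : ZMod m → M) (i : ZMod m) (s t : Fin 4) :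
    productMatrix p κ (κ + η) B c α β
      (![.inl i, .inl (i + κ), .inr i, .inr (i + κ)] s)
      (![.inl (i + κ), .inl i, .inr (i + κ), .inr i] t) =
    if s = t then ![α i, α i, α i * frob p m i B, α i * frob p m i B] s else 0 := by
  obtain ⟨h1, h2, h4, hη, hη0, e1, e2, e3, e4⟩ := hS
  fin_cases s <;> fin_cases t <;> simp [productMatrix] <;>
    grind

theorem productMatrix_edge_snd {κ η : ZMod m} (hS : ShiftFacts κ η) (B c : M)
    (α β : ZMod m → M) (i : ZMod m) (s t : Fin 4) :
    productMatrix p κ (κ + η) B c α β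
      (![.inl (i + (κ + η)), .inr i, .inl i, .inr (i + (κ + η))] s)
      (![.inr i, .inl (i + (κ + η)), .inr (i + (κ + η)), .inl i] t) =
    if s = t then ![β i, β i, β i * frob p m i c, β i * frob p m i c] s else 0 := by
  obtain ⟨h1, h2, h4, hη, hη0, e1, e2, e3, e4⟩ := hS
  fin_cases s <;> fin_cases t <;> simp [productMatrix] <;>
    grind



/-- The relation between the coefficients that forces zero divisors, at the index `i`. -/
theorem frob_index_ne [Finite M] [NeZero m] (hM : Nat.card M = p ^ m) {κ ρ : ZMod m} {B c : M}
    (hne : B * c * frob p m κ c ≠ frob p m ρ B) (i : ZMod m) :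
    frob p m i B * frob p m i c * frob p m (i + κ) c ≠ frob p m (i + ρ) B := by
  rw [← frob_frob hM, ← frob_frob hM, ← map_mul, ← map_mul]
  exact (frob p m i).injective.ne hne

variable [Fact p.Prime] [Algebra (ZMod p) M] [Finite M] [NeZero m]

theorem linearIndependent_coord_coe (hM : Nat.card M = p ^ m) :
    LinearIndependent M fun u (X : M × M) => coord p m u X := by
  have h := linearIndependent_coord (p := p) (M := M) hM
  rw [Fintype.linearIndependent_iff] at h ⊢
  intro a ha
  refine h a (LinearMap.ext fun X => ?_)
  have := congrFun ha X
  simp only [Finset.sum_apply, Pi.smul_apply] at this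
  rw [LinearMap.sum_apply]
  exact this

/-- The composition of the multiplication with the additive function that has the coefficients
`α` and `β` is of rank at most four. -/
def ProductRankLEFour (p : ℕ) {m : ℕ} [NeZero m] {M : Type*} [Field M] [ExpChar M p]
    (κ ρ : ZMod m) (B c : M) (α β : ZMod m → M) : Prop :=
  RankLEFour fun X Y => ∑ i, α i * frob p m i (mulFst p κ B X Y) +
    ∑ i, β i * frob p m i (mulSnd p ρ c X Y)

theorem ProductRankLEFour.entry_eq {κ ρ : ZMod m} {B c : M} {α β : ZMod m → M}
    (hr : ProductRankLEFour p κ ρ B c α β) (hM : Nat.card M = p ^ m)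
    {r s : Fin 4 → ZMod m ⊕ ZMod m} {w : Fin 4 → M} (hw : ∀ j, w j ≠ 0)
    (hrs : ∀ i j, productMatrix p κ ρ B c α β (r i) (s j) = if i = j then w i else 0)
    (u v : ZMod m ⊕ ZMod m) :
    productMatrix p κ ρ B c α β u v = ∑ j, productMatrix p κ ρ B c α β u (s j) *
      productMatrix p κ ρ B c α β (r j) v / w j := by
  unfold ProductRankLEFour at hr
  simp only [← sum_productMatrix hM] at hr
  exact RankLEFour.entry_eq (linearIndependent_coord_coe hM) hr hw hrs u v

-- For `a` at none of the listed places, the entry at `a`, `a + κ` is `α a` alone, while the block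
-- at `i` predicts the value 0 for it. Only a shift by κ + η lets products of two β's interfere.
set_option maxHeartbeats 4000000 in
theorem fst_support {κ η : ZMod m} (hS : ShiftFacts κ η) (hM : Nat.card M = p ^ m) {B c : M}
    (hB : B ≠ 0) (hne : B * c * frob p m κ c ≠ frob p m (κ + η) B) {α β : ZMod m → M}
    (hr : ProductRankLEFour p κ (κ + η) B c α β)
    {i a : ZMod m} (hi : α i ≠ 0) (ha : α a ≠ 0) :
    a = i ∨ a = i + κ ∨ i = a + κ ∨ a = i + η := by
  have hBi : ∀ i, frob p m i B ≠ 0 := fun i => frob_eq_zero.not.2 hB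
  -- The exception i = a + κ + η is harmless: it cannot hold in both directions, because 2κ ≠ 0 and
  -- 2η = 0.
  have key : ∀ i a : ZMod m, α i ≠ 0 → α a ≠ 0 →
      ¬(a = i ∨ a = i + κ ∨ i = a + κ ∨ a = i + η) → i = a + κ + η := by
    intro i a hi ha hia
    have hne := frob_index_ne hM hne i
    have hBi := hBi i
    have E := hr.entry_eq hM (w := ![α i, α i, α i * frob p m i B, α i * frob p m i B])
      (by intro j; fin_cases j <;> simp [hi, hBi]) (productMatrix_edge_fst hS B c α β i)
    have E1 := E (.inl a) (.inl (a + κ))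
    have E2 := E (.inr a) (.inr (a + κ))
    simp only [Fin.sum_univ_four, productMatrix, Matrix.cons_val] at E1 E2
    clear E hr
    obtain ⟨h1, h2, h4, hη, hη0, e1, e2, e3, e4⟩ := hS
    by_contra hc
    -- Here the x-entry and the y-entry both express `α a` by β_i β_(i+κ) / α_i; comparing them
    -- gives the equality excluded by `hne`.
    by_cases c1 : a = i + κ + η
    · subst c1
      have e : i + κ + η = i + (κ + η) := add_assoc _ _ _
      revert E1 E2 hi ha hne hBi
      simp (disch := grind) only [if_neg, if_true, add_zero, zero_add, zero_mul, mul_zero, zero_div]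
      have e' : i + κ + η + κ = i + κ + (κ + η) := by ring
      rw [if_pos e, if_pos e, if_pos e', if_pos e', e]
      intro hi hne hBi ha E1 E2
      refine hne (mul_left_cancel₀ (mul_ne_zero ha hi) ?_)
      field_simp at E1 E2
      linear_combination frob p m i c * frob p m (i + κ) c * E1 - E2
    clear E2
    rw [if_true, if_neg (by clear E1 hi ha hne hBi; grind), add_zero] at E1
    refine ha ?_
    rw [E1]
    clear E1 hi ha hne hBi
    by_cases c2 : a = i + 2 * κ
    · subst c2
      simp (disch := grind) only [if_neg, add_zero, zero_add, mul_zero, zero_div]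
    by_cases c3 : i = a + 2 * κ
    · subst c3
      simp (disch := grind) only [if_neg, add_zero, zero_add, zero_mul, mul_zero, zero_div]
    by_cases c4 : a = i + 2 * κ + η
    · subst c4
      simp (disch := grind) only [if_neg, add_zero, mul_zero, zero_div]
    by_cases c5 : i = a + 2 * κ + η
    · subst c5
      simp (disch := grind) only [if_neg, add_zero, zero_add, zero_mul, mul_zero, zero_div]
    simp (disch := grind) only [if_neg, add_zero, mul_zero, zero_div]
  by_contra hia
  have h1 := key i a hi ha hia
  have h2 := key a i ha hi (by grind [hS.eta_add])
  have := hS.two_ne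
  have := hS.eta_add
  grind


/-- If 3κ = 0, three indices are pairwise neighbours and `fst_support` does not separate them. The
diagonal entry at the third index is 0, but the block at `i` predicts 2 α_(i+κ) α_(i+2κ) / α_i,
which is nonzero in odd characteristic. -/
theorem fst_no_triangle {κ η : ZMod m} (hS : ShiftFacts κ η) (hM : Nat.card M = p ^ m) (hp : p ≠ 2)
    {B c : M} (hB : B ≠ 0) {α β : ZMod m → M} (hr : ProductRankLEFour p κ (κ + η) B c α β)
    (h3 : 3 * κ = 0) {i : ZMod m} (hi : α i ≠ 0) (hi' : α (i + κ) ≠ 0) :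
    α (i + 2 * κ) = 0 := by
  by_contra ha
  have hBi : frob p m i B ≠ 0 := frob_eq_zero.not.2 hB
  have E1 := hr.entry_eq hM (w := ![α i, α i, α i * frob p m i B, α i * frob p m i B])
    (by intro j; fin_cases j <;> simp [hi, hBi]) (productMatrix_edge_fst hS B c α β i)
    (.inl (i + 2 * κ)) (.inl (i + 2 * κ))
  have h2M : (2 : M) ≠ 0 := by
    have : CharP M p := charP_of_injective_algebraMap (algebraMap (ZMod p) M).injective p
    exact Ring.two_ne_zero (by rwa [ringChar.eq M p])
  simp only [Fin.sum_univ_four, productMatrix, Matrix.cons_val] at E1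
  clear hr
  obtain ⟨h1, h2, h4, hη, hη0, e1, e2, e3, e4⟩ := hS
  have e : i + 2 * κ = i + κ + κ := by ring
  have e' : i = i + 2 * κ + κ := by linear_combination -h3
  revert E1 hi hi' ha hBi h2M
  simp (disch := grind) only [if_neg, add_zero, zero_add, mul_zero, zero_div]
  rw [if_pos e, if_pos e']
  intro hi hi' ha hBi h2M E1
  field_simp at E1
  refine mul_ne_zero h2M (mul_ne_zero hi' ha) ?_
  linear_combination -E1

set_option maxHeartbeats 4000000 in
theorem snd_support {κ η : ZMod m} (hS : ShiftFacts κ η) (hM : Nat.card M = p ^ m) {B c : M}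
    (hc : c ≠ 0) (hne : B * c * frob p m κ c ≠ frob p m (κ + η) B)
    {α β : ZMod m → M} (hr : ProductRankLEFour p κ (κ + η) B c α β)
    {i a : ZMod m} (hi : β i ≠ 0) (ha : β a ≠ 0) :
    a = i ∨ a = i + (κ + η) ∨ i = a + (κ + η) ∨ a = i + η := by
  have hci : ∀ i, frob p m i c ≠ 0 := fun i => frob_eq_zero.not.2 hc
  have key : ∀ i a : ZMod m, β i ≠ 0 → β a ≠ 0 →
      ¬(a = i ∨ a = i + (κ + η) ∨ i = a + (κ + η) ∨ a = i + η) → i = a + κ := by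
    intro i a hi ha hia
    have hne := frob_index_ne hM hne i
    have hci := hci i
    have E := hr.entry_eq hM (w := ![β i, β i, β i * frob p m i c, β i * frob p m i c])
      (by intro j; fin_cases j <;> simp [hi, hci]) (productMatrix_edge_snd hS B c α β i)
    have E1 := E (.inl (a + (κ + η))) (.inr a)
    have E2 := E (.inl a) (.inr (a + (κ + η)))
    simp only [Fin.sum_univ_four, productMatrix, Matrix.cons_val] at E1 E2
    clear E hr
    obtain ⟨h1, h2, h4, hη, hη0, e1, e2, e3, e4⟩ := hS
    by_contra hc
    -- The two entries give α_(i+κ+η)-type products over β_i with different factors from B and c;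
    -- eliminating them again contradicts `hne`.
    by_cases c1 : a = i + κ
    · subst c1
      revert E1 E2 hi ha hne hci
      simp (disch := grind) only [if_neg, if_true, add_zero, zero_add, zero_mul, mul_zero, zero_div]
      have e : i + κ + (κ + η) = i + (κ + η) + κ := by ring
      rw [if_pos e, if_pos e]
      intro hi hne hci ha E1 E2
      refine hne (mul_left_cancel₀ (mul_ne_zero ha hi) ?_)
      field_simp at E1 E2
      linear_combination frob p m i B * E2 - frob p m (i + (κ + η)) B * E1
    clear E2
    rw [if_true, if_neg (by clear E1 hi ha hne hci; grind), add_zero] at E1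
    refine ha ?_
    rw [E1]
    clear E1 hi ha hne hci
    simp (disch := grind) only [if_neg, add_zero, zero_add, mul_zero, zero_div]
    by_cases c2 : a = i + (κ + η) + (κ + η)
    · rw [if_neg (c := i = a + (κ + η) + (κ + η)) (by grind),
        if_neg (c := i = a + (κ + η) + κ) (by grind)]
      simp only [zero_mul, zero_div, add_zero]
    rw [if_neg c2, mul_zero, zero_div, zero_add]
    by_cases c3 : a = i + (κ + η) + κ
    · rw [if_neg (c := i = a + (κ + η) + κ) (by grind), zero_mul, zero_div]
    rw [if_neg c3, mul_zero, zero_div]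
  by_contra hia
  have h1 := key i a hi ha hia
  have h2 := key a i ha hi (by grind [hS.eta_add])
  have := hS.two_ne
  grind

end Support

/-! ### Elements of odd order and the shifts κ, η -/

/-- `z` is of odd order in the additive group. -/
def OddOrder {G : Type*} [AddMonoid G] (z : G) : Prop := ∃ n : ℕ, Odd n ∧ n • z = 0

section OddOrder

variable {G : Type*} [AddCommGroup G] {x y : G}

theorem OddOrder.add (hx : OddOrder x) (hy : OddOrder y) : OddOrder (x + y) := by
  obtain ⟨a, ha, hax⟩ := hx
  obtain ⟨b, hb, hby⟩ := hy
  exact ⟨a * b, ha.mul hb, by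
    rw [smul_add, mul_smul a b y, hby, mul_comm, mul_smul, hax, smul_zero, smul_zero, add_zero]⟩

theorem OddOrder.neg (hx : OddOrder x) : OddOrder (-x) := by
  obtain ⟨a, ha, hax⟩ := hx
  exact ⟨a, ha, by rw [smul_neg, hax, neg_zero]⟩

theorem OddOrder.sub (hx : OddOrder x) (hy : OddOrder y) : OddOrder (x - y) :=
  sub_eq_add_neg x y ▸ hx.add hy.neg

theorem OddOrder.nsmul (hx : OddOrder x) (n : ℕ) : OddOrder (n • x) := by
  obtain ⟨a, ha, hax⟩ := hx
  exact ⟨a, ha, by rw [smul_comm, hax, smul_zero]⟩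

theorem OddOrder.eq_zero (hx : OddOrder x) (h : x + x = 0) : x = 0 := by
  obtain ⟨a, ⟨b, rfl⟩, hax⟩ := hx
  rw [add_smul, one_smul, mul_comm, mul_smul, two_smul, h, smul_zero, zero_add] at hax
  exact hax

end OddOrder

/-- Multiples of κ have odd order, so none of them equals η, and doubling is injective on them. -/
theorem ShiftFacts.of_oddOrder {m : ℕ} {κ η : ZMod m} (hκ : OddOrder κ) (h0 : κ ≠ 0)
    (hη : η + η = 0) (hη0 : η ≠ 0) : ShiftFacts κ η := by
  have hne : ∀ z : ZMod m, OddOrder z → z ≠ η := fun z hz e =>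
    hη0 (e ▸ hz.eq_zero (by rw [e, hη]))
  have h2 : 2 * κ ≠ 0 := fun h => h0 (hκ.eq_zero (by rw [← two_mul, h]))
  have hmul : ∀ n : ℕ, OddOrder ((n : ZMod m) * κ) := fun n => by
    rw [← nsmul_eq_mul]; exact hκ.nsmul n
  refine ⟨h0, h2, fun h => h2 ?_, hη, hη0, hne _ hκ, hne _ ?_, hne _ ?_, hne _ ?_⟩
  · exact (hmul 2).eq_zero (by rw [← h]; push_cast; ring)
  · exact_mod_cast hmul 2
  · exact_mod_cast hmul 3
  · exact_mod_cast hmul 4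

section Shift

variable {p m : ℕ} {M : Type*} [Field M]

theorem InFamily.oddOrder {k : ℕ} {B a : M} (h : InFamily p m k B a) :
    OddOrder (k : ZMod m) := by
  refine ⟨m / Nat.gcd k m, h.odd, ?_⟩
  rw [nsmul_eq_mul, ← Nat.cast_mul, ZMod.natCast_eq_zero_iff]
  obtain ⟨c, hc⟩ := Nat.gcd_dvd_left k m
  obtain ⟨d, hd⟩ := Nat.gcd_dvd_right k m
  have hpos : 0 < Nat.gcd k m := Nat.gcd_pos_of_pos_left _ h.one_le
  have : m / Nat.gcd k m = d := Nat.div_eq_of_eq_mul_right hpos hd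
  rw [this]
  exact ⟨c, by conv_lhs => rw [hc]
               conv_rhs => rw [hd]
               ring⟩

theorem InFamily.natCast_ne_zero {k : ℕ} {B a : M} (h : InFamily p m k B a) :
    (k : ZMod m) ≠ 0 := by
  rw [Ne, ZMod.natCast_eq_zero_iff]
  exact fun hd => absurd (Nat.le_of_dvd h.one_le hd) (not_le.2 h.lt)

theorem half_add_half (hm : Even m) : ((m / 2 : ℕ) : ZMod m) + ((m / 2 : ℕ) : ZMod m) = 0 := by
  rw [← Nat.cast_add, ← two_mul, Nat.two_mul_div_two_of_even hm, ZMod.natCast_self]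

theorem half_ne_zero (hm : Even m) (h0 : 0 < m) : ((m / 2 : ℕ) : ZMod m) ≠ 0 := by
  obtain ⟨j, rfl⟩ := hm
  rw [Ne, ZMod.natCast_eq_zero_iff]
  exact fun hd => absurd (Nat.le_of_dvd (by omega) hd) (by omega)

theorem not_oddOrder_half (hm : Even m) (h0 : 0 < m) : ¬OddOrder ((m / 2 : ℕ) : ZMod m) :=
  fun h => half_ne_zero hm h0 (h.eq_zero (half_add_half hm))

theorem InFamily.pos {k : ℕ} {B a : M} (h : InFamily p m k B a) : 0 < m :=
  (Nat.zero_le _).trans_lt h.lt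

theorem InFamily.shiftFacts {k : ℕ} {B a : M} (h : InFamily p m k B a) :
    ShiftFacts (k : ZMod m) ((m / 2 : ℕ) : ZMod m) :=
  .of_oddOrder h.oddOrder h.natCast_ne_zero (half_add_half h.even) (half_ne_zero h.even h.pos)

theorem InFamily.ne_zero' {k : ℕ} {B a : M} (h : InFamily p m k B a) : B ≠ 0 :=
  fun h0 => h.nonsquare (h0 ▸ IsSquare.zero)

end Shift

/-! ### Squares, norms and nondegeneracy -/

section Square

variable {p m : ℕ} {M : Type*} [Field M]

theorem exists_half [Fact p.Prime] (hp : p ≠ 2) (n : ℕ) : ∃ j, p ^ n = 2 * j + 1 :=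
  ((Fact.out : p.Prime).odd_of_ne_two hp).pow

theorem pow_sub_one_eq_one_of_pow_eq {x : M} {n : ℕ} (hx : x ≠ 0) (h : x ^ (n + 1) = x) :
    x ^ n = 1 :=
  mul_right_cancel₀ hx (by rw [← pow_succ, h, one_mul])

variable [Finite M]

/-- With Q = 2j + 1 the exponent j(Q + 1) is (Q² - 1)/2, so this is Euler's criterion. -/
theorem pow_card_half [CharP M p] (hp : p ≠ 2) (hM : Nat.card M = p ^ m) (hm : Even m) {j : ℕ}
    (hj : p ^ (m / 2) = 2 * j + 1) {x : M} (hx : x ≠ 0) :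
    (IsSquare x → x ^ (j * (p ^ (m / 2) + 1)) = 1) ∧
      (¬IsSquare x → x ^ (j * (p ^ (m / 2) + 1)) = -1) := by
  have : Fintype M := Fintype.ofFinite M
  have hchar : ringChar M ≠ 2 := by rwa [ringChar.eq M p]
  have hcard : Fintype.card M / 2 = j * (p ^ (m / 2) + 1) := by
    have h1 : p ^ m = p ^ (m / 2) * p ^ (m / 2) := by
      rw [← pow_add, ← two_mul, Nat.two_mul_div_two_of_even hm]
    rw [← Nat.card_eq_fintype_card, hM, h1, hj]
    have : (2 * j + 1) * (2 * j + 1) = 2 * (j * (2 * j + 1 + 1)) + 1 := by ring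
    omega
  rw [FiniteField.isSquare_iff hchar hx, hcard]
  refine ⟨id, fun h => ?_⟩
  have := FiniteField.pow_dichotomy hchar hx
  rw [hcard] at this
  exact this.resolve_left h

variable [Fact p.Prime]

/-- The norm of a non-square to the subfield with `Q` elements is not a square there. -/
theorem InFamily.pow_ne [CharP M p] (hp : p ≠ 2) (hM : Nat.card M = p ^ m) {k : ℕ} {B a : M}
    (h : InFamily p m k B a) :
    B ^ (p ^ k * (p ^ (m / 2) + 1)) ≠ a ^ (p ^ k + 1) := by
  intro e
  obtain ⟨j, hj⟩ := exists_half (p := p) hp (m / 2)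
  obtain ⟨i, hi⟩ := exists_half (p := p) hp k
  have h1 := (pow_card_half hp hM h.even hj h.ne_zero').2 h.nonsquare
  have h2 : a ^ (2 * j) = 1 := pow_sub_one_eq_one_of_pow_eq h.ne_zero (by
    rw [← hj]; exact h.mem_subfield)
  have h3 : (-1 : M) ^ p ^ k = -1 := Odd.neg_one_pow ⟨i, hi⟩
  -- Both sides of `e` are raised to the power j = (Q - 1)/2, the quadratic character of 𝕃.
  have h4 : (-1 : M) = 1 := by
    calc (-1 : M) = (B ^ (j * (p ^ (m / 2) + 1))) ^ p ^ k := by rw [h1, h3]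
      _ = (B ^ (p ^ k * (p ^ (m / 2) + 1))) ^ j := by rw [← pow_mul, ← pow_mul]; ring_nf
      _ = (a ^ (2 * j)) ^ (i + 1) := by
        rw [e, hi, ← pow_mul, ← pow_mul]; ring_nf
      _ = 1 := by rw [h2, one_pow]
  have : Fact (2 < p) := ⟨lt_of_le_of_ne (Fact.out : p.Prime).two_le hp.symm⟩
  exact CharP.neg_one_ne_one M p h4

theorem InFamily.nondegenerate [CharP M p] [NeZero m] (hp : p ≠ 2) (hM : Nat.card M = p ^ m)
    {k : ℕ} {B a : M} (h : InFamily p m k B a) :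
    B * (a / B) * frob p m (k : ZMod m) (a / B) ≠
      frob p m ((k : ZMod m) + ((m / 2 : ℕ) : ZMod m)) B := by
  intro e
  refine h.pow_ne hp hM ?_
  rw [← Nat.cast_add, ← pow_eq_frob hM, ← pow_eq_frob hM, div_pow] at e
  have hB := h.ne_zero'
  field_simp at e
  rw [mul_add, mul_one, ← pow_add, pow_add, pow_succ]
  rw [← pow_add] at e
  linear_combination -e

end Square

/-- Each of the three conditions excludes at most one `x`. -/
theorem exists_add_mul_ne_zero {K : Type*} [Field K] [Finite K] (hK : 3 < Nat.card K)
    (a b : Fin 3 → K) (h : ∀ j, a j ≠ 0 ∨ b j ≠ 0) : ∃ x, ∀ j, a j + x * b j ≠ 0 := by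
  classical
  have : Fintype K := Fintype.ofFinite K
  by_contra! hc
  have hsub : (Finset.univ : Finset K) ⊆ Finset.univ.image fun j => -a j / b j := by
    intro x _
    obtain ⟨j, hj⟩ := hc x
    have hb : b j ≠ 0 := by
      intro hb
      rw [hb, mul_zero, add_zero] at hj
      exact (h j).elim (fun h => h hj) fun h => h hb
    exact Finset.mem_image.2 ⟨j, Finset.mem_univ _, by
      rw [div_eq_iff hb]; linear_combination -hj⟩
  have h1 := (Finset.card_le_card hsub).trans Finset.card_image_le
  rw [Finset.card_univ, ← Nat.card_eq_fintype_card, Finset.card_univ, Fintype.card_fin] at h1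
  omega

/-! ### The rank of the pencils on the target side -/

section Rank

variable {p m : ℕ} {M : Type*} [Field M] [ExpChar M p]

/-- The terms X^q Y and X^q Y^(q²) share a factor, and so do X Y^q and X^(q²) Y^q; adding a multiple
of the q-th power creates no new products. -/
theorem rankLEFour_fst {V : Type*} (κ : ZMod m) (B x : M) (L K : V → M × M) :
    RankLEFour fun X Y => mulFst p κ B (L X) (K Y) + x * frob p m κ (mulFst p κ B (L X) (K Y)) := by
  refine ⟨![fun X => frob p m κ (L X).1, fun X => (L X).1 + x * frob p m κ (frob p m κ (L X).1),
      fun X => frob p m κ (L X).2,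
      fun X => B * (L X).2 + x * frob p m κ B * frob p m κ (frob p m κ (L X).2)],
    ![fun Y => (K Y).1 + x * frob p m κ (frob p m κ (K Y).1), fun Y => frob p m κ (K Y).1,
      fun Y => B * (K Y).2 + x * frob p m κ B * frob p m κ (frob p m κ (K Y).2),
      fun Y => frob p m κ (K Y).2], fun X Y => ?_⟩
  simp only [mulFst, Fin.sum_univ_four, Matrix.cons_val, map_add, map_mul]
  ring

theorem rankLEFour_snd {V : Type*} (ρ : ZMod m) (c x : M) (L K : V → M × M) :
    RankLEFour fun X Y => mulSnd p ρ c (L X) (K Y) + x * frob p m ρ (mulSnd p ρ c (L X) (K Y)) := by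
  refine ⟨![fun X => frob p m ρ (L X).1, fun X => frob p m ρ (L X).2,
      fun X => (L X).2 + x * frob p m ρ c * frob p m ρ (frob p m ρ (L X).2),
      fun X => c * (L X).1 + x * frob p m ρ (frob p m ρ (L X).1)],
    ![fun Y => (K Y).2 + x * frob p m ρ c * frob p m ρ (frob p m ρ (K Y).2),
      fun Y => c * (K Y).1 + x * frob p m ρ (frob p m ρ (K Y).1),
      fun Y => frob p m ρ (K Y).1, fun Y => frob p m ρ (K Y).2], fun X Y => ?_⟩
  simp only [mulSnd, Fin.sum_univ_four, Matrix.cons_val, map_add, map_mul]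
  ring

end Rank

/-! ### The components of N are monomials -/

section Monomial

variable {p m : ℕ} [Fact p.Prime] {M : Type*} [Field M] [Algebra (ZMod p) M] [Finite M]
  [ExpChar M p] [NeZero m]

/-- The forms `n + x n ^ p ^ d`, composed with the multiplication, are of rank at most four. -/
def PencilRankLEFour (hM : Nat.card M = p ^ m) (κ ρ : ZMod m) (B c : M) (d : ZMod m)
    (n : M × M →ₗ[ZMod p] M) : Prop :=
  ∀ x : M, ProductRankLEFour p κ ρ B c
    (fun i => (coordBasis hM).repr n (.inl i) +
      x * frob p m d ((coordBasis hM).repr n (.inl (i - d))))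
    (fun i => (coordBasis hM).repr n (.inr i) +
      x * frob p m d ((coordBasis hM).repr n (.inr (i - d))))

theorem pencilRankLEFour_of (hM : Nat.card M = p ^ m) (κ ρ : ZMod m) (B c : M) (d : ZMod m)
    (n : M × M →ₗ[ZMod p] M)
    (h : ∀ x : M, RankLEFour fun X Y => n (mulFst p κ B X Y, mulSnd p ρ c X Y) +
      x * frob p m d (n (mulFst p κ B X Y, mulSnd p ρ c X Y))) :
    PencilRankLEFour hM κ ρ B c d n := by
  intro x
  unfold ProductRankLEFour
  convert h x using 3 with X Y
  have h1 := eq_sum_repr hM (n + x • (frobLin p m d ∘ₗ n)) (mulFst p κ B X Y, mulSnd p ρ c X Y)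
  simp only [map_add, map_smul, Finsupp.add_apply, Finsupp.smul_apply, (repr_frob_comp hM n d _).1,
    (repr_frob_comp hM n d _).2, smul_eq_mul] at h1
  exact h1.symm

variable {κ η d : ZMod m} {B c : M} {n : M × M →ₗ[ZMod p] M}

theorem PencilRankLEFour.fst_pair {hM : Nat.card M = p ^ m} (hK : 3 < Nat.card M)
    (hn : PencilRankLEFour hM κ (κ + η) B c d n) (hS : ShiftFacts κ η)
    (hB : B ≠ 0) (hne : B * c * frob p m κ c ≠ frob p m (κ + η) B) {i j : ZMod m}
    (hi : (coordBasis hM).repr n (.inl i) ≠ 0) (hj : (coordBasis hM).repr n (.inl j) ≠ 0) :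
    j + d = i ∨ j + d = i + κ ∨ i = j + d + κ ∨ j + d = i + η := by
  obtain ⟨x, hx⟩ := exists_add_mul_ne_zero hK
    ![(coordBasis hM).repr n (.inl i), (coordBasis hM).repr n (.inl (j + d)), 1]
    ![frob p m d ((coordBasis hM).repr n (.inl (i - d))),
      frob p m d ((coordBasis hM).repr n (.inl j)), 0]
    (by simp [Fin.forall_fin_succ, hi, hj])
  simp only [Fin.forall_fin_succ] at hx
  exact fst_support hS hM hB hne (hn x) hx.1 (by simpa using hx.2.1)

theorem PencilRankLEFour.snd_pair {hM : Nat.card M = p ^ m} (hK : 3 < Nat.card M)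
    (hn : PencilRankLEFour hM κ (κ + η) B c d n) (hS : ShiftFacts κ η)
    (hc : c ≠ 0) (hne : B * c * frob p m κ c ≠ frob p m (κ + η) B) {i j : ZMod m}
    (hi : (coordBasis hM).repr n (.inr i) ≠ 0) (hj : (coordBasis hM).repr n (.inr j) ≠ 0) :
    j + d = i ∨ j + d = i + (κ + η) ∨ i = j + d + (κ + η) ∨ j + d = i + η := by
  obtain ⟨x, hx⟩ := exists_add_mul_ne_zero hK
    ![(coordBasis hM).repr n (.inr i), (coordBasis hM).repr n (.inr (j + d)), 1]
    ![frob p m d ((coordBasis hM).repr n (.inr (i - d))),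
      frob p m d ((coordBasis hM).repr n (.inr j)), 0]
    (by simp [Fin.forall_fin_succ, hi, hj])
  simp only [Fin.forall_fin_succ] at hx
  exact snd_support hS hM hc hne (hn x) hx.1 (by simpa using hx.2.1)

/-- Comparing an index with itself constrains only `d`: a coefficient of some y^(p^i) would make η a
sum of elements of odd order, and one of x^(p^i) leaves d = ±κ. Two different indices could coexist
only if 3κ = 0, where they complete to a triangle. -/
theorem PencilRankLEFour.fst_monomial {hM : Nat.card M = p ^ m} (hK : 3 < Nat.card M) (hp : p ≠ 2)
    (hn : PencilRankLEFour hM κ (κ + η) B c d n) (hS : ShiftFacts κ η) (hκ : OddOrder κ)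
    (hη : ¬OddOrder η) (hd : OddOrder d) (hd0 : d ≠ 0)
    (hB : B ≠ 0) (hc : c ≠ 0) (hne : B * c * frob p m κ c ≠ frob p m (κ + η) B) (hn0 : n ≠ 0) :
    (d = κ ∨ d = -κ) ∧ ∃ t α, α ≠ 0 ∧ ∀ X, n X = α * frob p m t X.1 := by
  have hr : ∀ i, (coordBasis hM).repr n (.inr i) = 0 := by
    intro i
    by_contra hi
    rcases hn.snd_pair hK hS hc hne hi hi with h | h | h | h
    · exact hd0 (by simpa using h)
    · exact hη ((show d - κ = η by linear_combination h) ▸ hd.sub hκ)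
    · exact hη ((show -(d + κ) = η by linear_combination h) ▸ (hd.add hκ).neg)
    · exact hη ((show d = η by linear_combination h) ▸ hd)
  obtain ⟨t, ht⟩ : ∃ t, (coordBasis hM).repr n (.inl t) ≠ 0 := by
    by_contra! hall
    refine hn0 (LinearMap.ext fun X => ?_)
    rw [eq_sum_repr hM n X]
    simp [hall, hr]
  have hdκ : d = κ ∨ d = -κ := by
    rcases hn.fst_pair hK hS hB hne ht ht with h | h | h | h
    · exact absurd (by simpa using h) hd0
    · exact .inl (by linear_combination h)
    · exact .inr (by linear_combination -h)
    · exact absurd ((show d = η by linear_combination h) ▸ hd) hη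
  -- The third vertex is supplied by the power of `n`: its coefficient at i + 2κ comes from index i
  -- + κ if d = κ, and from i + 3κ = i if d = -κ.
  have tri : ∀ i, (coordBasis hM).repr n (.inl i) ≠ 0 →
      (coordBasis hM).repr n (.inl (i + κ)) ≠ 0 → 3 * κ ≠ 0 := by
    intro i hi hi' h3
    obtain ⟨x, hx⟩ := exists_add_mul_ne_zero hK
      ![(coordBasis hM).repr n (.inl i), (coordBasis hM).repr n (.inl (i + κ)),
        (coordBasis hM).repr n (.inl (i + 2 * κ))]
      ![frob p m d ((coordBasis hM).repr n (.inl (i - d))),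
        frob p m d ((coordBasis hM).repr n (.inl (i + κ - d))),
        frob p m d ((coordBasis hM).repr n (.inl (i + 2 * κ - d)))]
      (by
        simp only [Fin.forall_fin_succ]
        refine ⟨.inl hi, .inl hi', .inr ?_, fun j => j.elim0⟩
        refine frob_eq_zero.not.2 ?_
        rcases hdκ with rfl | rfl
        · convert hi' using 4
          ring
        · convert hi using 4
          linear_combination h3)
    exact hx 2 (fst_no_triangle hS hM hp hB (hn x) h3 (hx 0) (hx 1))
  refine ⟨hdκ, t, _, ht, fun X => ?_⟩
  rw [eq_sum_repr hM n X]
  simp only [hr, zero_mul, Finset.sum_const_zero, add_zero]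
  refine Finset.sum_eq_single t (fun j _ hjt => ?_) fun h => absurd (Finset.mem_univ _) h
  by_contra hj
  replace hj := left_ne_zero_of_mul hj
  have f1 := hn.fst_pair hK hS hB hne ht hj
  have f2 := hn.fst_pair hK hS hB hne hj ht
  have hcase : 3 * κ = 0 ∧ (j = t + κ ∨ t = j + κ) := by
    clear hj ht tri hr hn hne
    obtain ⟨h1, h2, h4, hη, hη0, e1, e2, e3, e4⟩ := hS
    rcases hdκ with rfl | rfl <;> rcases f1 with f1 | f1 | f1 | f1 <;> grind
  obtain ⟨h3, rfl | rfl⟩ := hcase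
  · exact tri _ ht hj h3
  · exact tri _ hj ht h3

theorem snd_index_unique {R : Type*} [CommRing R] {κ η d t j : R} (hη : η + η = 0) (h0 : η ≠ 0)
    (h2 : 2 * κ ≠ 0) (h4 : 4 * κ ≠ 0) (n1 : κ ≠ η) (n3 : 3 * κ ≠ η) (hd : d = κ ∨ d = -κ)
    (e : j = t + (κ + η) ∨ t = j + (κ + η) ∨ j = t + η)
    (f1 : j + (d + η) = t ∨ j + (d + η) = t + (κ + η) ∨ t = j + (d + η) + (κ + η) ∨
      j + (d + η) = t + η)
    (f2 : t + (d + η) = j ∨ t + (d + η) = j + (κ + η) ∨ j = t + (d + η) + (κ + η) ∨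
      t + (d + η) = j + η) : False := by
  have e5 : 3 * κ + 3 * η ≠ 0 := fun h => n3 (by linear_combination h - 2 * hη)
  grind

theorem PencilRankLEFour.snd_monomial {hM : Nat.card M = p ^ m} (hK : 3 < Nat.card M)
    (hn : PencilRankLEFour hM κ (κ + η) B c (d + η) n) (hS : ShiftFacts κ η) (hκ : OddOrder κ)
    (hη : ¬OddOrder η) (hd : OddOrder d) (hd0 : d ≠ 0)
    (hB : B ≠ 0) (hc : c ≠ 0) (hne : B * c * frob p m κ c ≠ frob p m (κ + η) B) (hn0 : n ≠ 0) :
    ∃ t β, β ≠ 0 ∧ ∀ X, n X = β * frob p m t X.2 := by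
  have hl : ∀ i, (coordBasis hM).repr n (.inl i) = 0 := by
    intro i
    by_contra hi
    rcases hn.fst_pair hK hS hB hne hi hi with h | h | h | h
    · exact hη ((show -d = η by linear_combination -h) ▸ hd.neg)
    · exact hη ((show κ - d = η by linear_combination -h) ▸ hκ.sub hd)
    · exact hη ((show -(d + κ) = η by linear_combination h) ▸ (hd.add hκ).neg)
    · exact hd0 (by linear_combination h)
  obtain ⟨t, ht⟩ : ∃ t, (coordBasis hM).repr n (.inr t) ≠ 0 := by
    by_contra! hall
    refine hn0 (LinearMap.ext fun X => ?_)
    rw [eq_sum_repr hM n X]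
    simp [hall, hl]
  refine ⟨t, _, ht, fun X => ?_⟩
  rw [eq_sum_repr hM n X]
  simp only [hl, zero_mul, Finset.sum_const_zero, zero_add]
  refine Finset.sum_eq_single t (fun j _ hjt => ?_) fun h => absurd (Finset.mem_univ _) h
  by_contra hj
  replace hj := left_ne_zero_of_mul hj
  have e0 := hn.snd_pair hK hS hc hne ht ht
  have f1 := hn.snd_pair hK hS hc hne ht hj
  have f2 := hn.snd_pair hK hS hc hne hj ht
  -- At x = 0 the pencil is `n` itself, which gives a restriction on t and j not involving d.
  have e' := snd_support hS hM hc hne (hn 0) (i := t) (a := j) (by simpa using ht)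
    (by simpa using hj)
  have hdη : d + η ≠ 0 := fun h => hη ((show -d = η by linear_combination -h) ▸ hd.neg)
  have hdκ : d = κ ∨ d = -κ := by
    rcases e0 with h | h | h | h
    · exact absurd (by linear_combination h) hdη
    · exact .inl (by linear_combination h)
    · exact .inr (by linear_combination -h - hS.eta_add)
    · exact absurd (by linear_combination h) hd0
  exact snd_index_unique hS.eta_add hS.eta_ne hS.two_ne hS.four_ne hS.ne_eta hS.three_ne_eta hdκ
    (e'.resolve_left hjt) f1 f2

end Monomial

section Comm

variable {p m : ℕ} {M : Type*} [Field M] [ExpChar M p]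

theorem mulFst_comm (κ : ZMod m) (B : M) (X Y : M × M) : mulFst p κ B X Y = mulFst p κ B Y X := by
  unfold mulFst
  ring

end Comm

section Monomials

/-! ### Independence of the monomials x^(p^d) y and x y^(p^d) -/

variable {p m : ℕ} [Fact p.Prime] {M : Type*} [Field M] [Finite M] [ExpChar M p] [NeZero m]

/-- The monomials `x ^ p ^ d * y` and `x * y ^ p ^ d` are linearly independent. -/
theorem eq_zero_of_forall_monomials (hM : Nat.card M = p ^ m) {d : ZMod m} (hd : d ≠ 0) {P P' : M}
    (h : ∀ x y, P * (frob p m d x * y) + P' * (x * frob p m d y) = 0) : P = 0 ∧ P' = 0 := by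
  have h1 : P + P' = 0 := by simpa using h 1 1
  have hP : P = 0 := by
    by_contra hP
    refine hd (frob_injective_index (M := M) (Fact.out : p.Prime).one_lt hM ?_)
    refine MonoidHom.ext fun x => mul_left_cancel₀ hP ?_
    have := h x 1
    simp only [map_one, mul_one] at this
    change P * frob p m d x = P * frob p m 0 x
    rw [frob_zero]
    linear_combination this - x * h1
  exact ⟨hP, by rw [hP, zero_add] at h1; exact h1⟩

end Monomials

/-! ### The shape of L and K -/

section Shape

variable {p m : ℕ} [Fact p.Prime] {M : Type*} [Field M] [Algebra (ZMod p) M] [Finite M]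
  [ExpChar M p] [NeZero m]

/-- The additive functions all of whose coefficients outside of `T` vanish. -/
noncomputable def coordSupported (hM : Nat.card M = p ^ m) (T : Set (ZMod m ⊕ ZMod m)) :
    Submodule M (M × M →ₗ[ZMod p] M) :=
  (Finsupp.supported M M T).comap (coordBasis hM).repr.toLinearMap

theorem mem_coordSupported {hM : Nat.card M = p ^ m} {T : Set (ZMod m ⊕ ZMod m)}
    {n : M × M →ₗ[ZMod p] M} :
    n ∈ coordSupported hM T ↔ ∀ u ∉ T, (coordBasis hM).repr n u = 0 := by
  simp [coordSupported, Finsupp.mem_supported']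

theorem coord_mem_coordSupported {hM : Nat.card M = p ^ m} {T : Set (ZMod m ⊕ ZMod m)}
    {u : ZMod m ⊕ ZMod m} (hu : u ∈ T) : coord p m u ∈ coordSupported hM T := by
  rw [mem_coordSupported]
  intro v hv
  rw [← coordBasis_apply hM, Module.Basis.repr_self, Finsupp.single_apply, if_neg]
  rintro rfl
  exact hv hu

theorem linearIndependent_coord_comp (hM : Nat.card M = p ^ m) {K : M × M → M × M}
    (hK : Function.Surjective K) {T : Fin 4 → ZMod m ⊕ ZMod m} (hT : Function.Injective T) :
    LinearIndependent M fun j (Y : M × M) => coord p m (T j) (K Y) := by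
  have h : LinearIndependent M fun u (Y : M × M) => coord p m u (K Y) := by
    have h := linearIndependent_coord_coe (p := p) (M := M) hM
    rw [Fintype.linearIndependent_iff] at h ⊢
    intro a ha
    refine h a (funext fun X => ?_)
    obtain ⟨Y, rfl⟩ := hK X
    have := congrFun ha Y
    simp only [Finset.sum_apply, Pi.smul_apply] at this ⊢
    exact this
  exact h.comp T hT

/-- The indices of the four coordinates that occur in `mulFst ^ p ^ t` and `mulSnd ^ p ^ t`. -/
def pairIndices {m : ℕ} (t d : ZMod m) : Set (ZMod m ⊕ ZMod m) :=
  {.inl t, .inl (t + d), .inr t, .inr (t + d)}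

variable {κ ρ t : ZMod m} {B B' c c' α β : M} {L K : (M × M) ≃ₗ[ZMod p] (M × M)}

theorem mem_of_fst_eq (hM : Nat.card M = p ^ m) (hκ : κ ≠ 0) (hB : B' ≠ 0)
    (h : ∀ X Y, α * frob p m t (mulFst p κ B X Y) = mulFst p κ B' (L X) (K Y)) :
    (LinearMap.fst _ _ _ ∘ₗ L.toLinearMap ∈ coordSupported hM (pairIndices t κ) ∧
      frobLin p m κ ∘ₗ LinearMap.fst _ _ _ ∘ₗ L.toLinearMap ∈
        coordSupported hM (pairIndices t κ)) ∧
    (LinearMap.snd _ _ _ ∘ₗ L.toLinearMap ∈ coordSupported hM (pairIndices t κ) ∧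
      frobLin p m κ ∘ₗ LinearMap.snd _ _ _ ∘ₗ L.toLinearMap ∈
        coordSupported hM (pairIndices t κ)) := by
  set S := coordSupported hM (pairIndices t κ)
  have hli := linearIndependent_coord_comp hM K.surjective
    (T := ![.inl 0, .inl κ, .inr 0, .inr κ]) (by
      intro i j hij
      fin_cases i <;> fin_cases j <;> simp_all)
  have hmem := mem_of_sum_smul_mem hli S
    ![frobLin p m κ ∘ₗ LinearMap.fst _ _ _ ∘ₗ L.toLinearMap,
      LinearMap.fst _ _ _ ∘ₗ L.toLinearMap,
      B' • (frobLin p m κ ∘ₗ LinearMap.snd _ _ _ ∘ₗ L.toLinearMap),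
      B' • (LinearMap.snd _ _ _ ∘ₗ L.toLinearMap)] (fun Y => by
        -- For fixed Y the left side of `h` is a combination of four coordinates of X. On the right
        -- side the coordinates of K Y are independent functions of Y, so each of their coefficients
        -- is such a combination.
        have : (α * frob p m t Y.1) • coord p m (M := M) (.inl (t + κ)) +
            (α * frob p m (t + κ) Y.1) • coord p m (.inl t) +
            (α * frob p m t B * frob p m t Y.2) • coord p m (.inr (t + κ)) +
            (α * frob p m t B * frob p m (t + κ) Y.2) • coord p m (.inr t) ∈ S := by
          refine S.add_mem (S.add_mem (S.add_mem ?_ ?_) ?_) ?_ <;>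
            exact S.smul_mem _ (coord_mem_coordSupported (by simp [pairIndices]))
        convert this using 1
        ext1 <;> ext x
        · have := h (x, 0) Y
          simp [mulFst, frob_frob hM] at this
          simp [Fin.sum_univ_four, frob_zero]
          linear_combination -this
        · have := h (0, x) Y
          simp [mulFst, frob_frob hM] at this
          simp [Fin.sum_univ_four, frob_zero]
          linear_combination -this)
  exact ⟨⟨hmem 1, hmem 0⟩, (S.smul_mem_iff hB).1 (hmem 3), (S.smul_mem_iff hB).1 (hmem 2)⟩

theorem mem_of_snd_eq (hM : Nat.card M = p ^ m) (hρ : ρ ≠ 0) (hc : c' ≠ 0)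
    (h : ∀ X Y, β * frob p m t (mulSnd p ρ c X Y) = mulSnd p ρ c' (L X) (K Y)) :
    LinearMap.fst _ _ _ ∘ₗ L.toLinearMap ∈ coordSupported hM (pairIndices t ρ) ∧
      frobLin p m ρ ∘ₗ LinearMap.fst _ _ _ ∘ₗ L.toLinearMap ∈
        coordSupported hM (pairIndices t ρ) := by
  set S := coordSupported hM (pairIndices t ρ)
  have hli := linearIndependent_coord_comp hM K.surjective
    (T := ![.inl 0, .inl ρ, .inr 0, .inr ρ]) (by
      intro i j hij
      fin_cases i <;> fin_cases j <;> simp_all)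
  have hmem := mem_of_sum_smul_mem hli S
    ![c' • (frobLin p m ρ ∘ₗ LinearMap.snd _ _ _ ∘ₗ L.toLinearMap),
      LinearMap.snd _ _ _ ∘ₗ L.toLinearMap,
      frobLin p m ρ ∘ₗ LinearMap.fst _ _ _ ∘ₗ L.toLinearMap,
      c' • (LinearMap.fst _ _ _ ∘ₗ L.toLinearMap)] (fun Y => by
        have : (β * frob p m t Y.2) • coord p m (M := M) (.inl (t + ρ)) +
            (β * frob p m (t + ρ) Y.1) • coord p m (.inr t) +
            (β * frob p m t c * frob p m (t + ρ) Y.2) • coord p m (.inl t) +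
            (β * frob p m t c * frob p m t Y.1) • coord p m (.inr (t + ρ)) ∈ S := by
          refine S.add_mem (S.add_mem (S.add_mem ?_ ?_) ?_) ?_ <;>
            exact S.smul_mem _ (coord_mem_coordSupported (by simp [pairIndices]))
        convert this using 1
        ext1 <;> ext x
        · have := h (x, 0) Y
          simp [mulSnd, frob_frob hM] at this
          simp [Fin.sum_univ_four, frob_zero]
          linear_combination -this
        · have := h (0, x) Y
          simp [mulSnd, frob_frob hM] at this
          simp [Fin.sum_univ_four, frob_zero]
          linear_combination -this)
  exact ⟨(S.smul_mem_iff hc).1 (hmem 3), hmem 2⟩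

/-- A term of index t + κ in `n` would give one of index t + 2κ in its power, which is outside the
allowed set. -/
theorem eq_of_mem_of_frob_mem {hM : Nat.card M = p ^ m} {n : M × M →ₗ[ZMod p] M}
    (hκ : κ ≠ 0) (h2 : 2 * κ ≠ 0) (h : n ∈ coordSupported hM (pairIndices t κ))
    (h' : frobLin p m κ ∘ₗ n ∈ coordSupported hM (pairIndices t κ)) :
    ∃ x y, ∀ X, n X = x * frob p m t X.1 + y * frob p m t X.2 := by
  rw [mem_coordSupported] at h h'
  have h2' : κ + κ ≠ 0 := by rwa [← two_mul]
  have hl : ∀ i, i ≠ t → (coordBasis hM).repr n (.inl i) = 0 := by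
    intro i hi
    by_cases hi' : i = t + κ
    · have := h' (.inl (i + κ)) (by simp [pairIndices, hi', add_assoc, hκ, h2'])
      rwa [(repr_frob_comp hM n κ _).1, frob_eq_zero, add_sub_cancel_right] at this
    · exact h _ (by simp [pairIndices, hi, hi'])
  have hr : ∀ i, i ≠ t → (coordBasis hM).repr n (.inr i) = 0 := by
    intro i hi
    by_cases hi' : i = t + κ
    · have := h' (.inr (i + κ)) (by simp [pairIndices, hi', add_assoc, hκ, h2'])
      rwa [(repr_frob_comp hM n κ _).2, frob_eq_zero, add_sub_cancel_right] at this
    · exact h _ (by simp [pairIndices, hi, hi'])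
  refine ⟨(coordBasis hM).repr n (.inl t), (coordBasis hM).repr n (.inr t), fun X => ?_⟩
  rw [eq_sum_repr hM n X, Finset.sum_eq_single t, Finset.sum_eq_single t]
  · exact fun j _ hj => by rw [hr j hj, zero_mul]
  · simp
  · exact fun j _ hj => by rw [hl j hj, zero_mul]
  · simp

theorem exists_shape_of_fst_eq (hM : Nat.card M = p ^ m) (hκ : κ ≠ 0) (h2 : 2 * κ ≠ 0)
    (hB : B' ≠ 0) (h : ∀ X Y, α * frob p m t (mulFst p κ B X Y) = mulFst p κ B' (L X) (K Y)) :
    ∃ l₁ l₂ l₃ l₄, ∀ X, L X = (l₁ * frob p m t X.1 + l₂ * frob p m t X.2,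
      l₃ * frob p m t X.1 + l₄ * frob p m t X.2) := by
  obtain ⟨⟨h1, h1'⟩, h3, h3'⟩ := mem_of_fst_eq hM hκ hB h
  obtain ⟨l₁, l₂, hl⟩ := eq_of_mem_of_frob_mem hκ h2 h1 h1'
  obtain ⟨l₃, l₄, hl'⟩ := eq_of_mem_of_frob_mem hκ h2 h3 h3'
  exact ⟨l₁, l₂, l₃, l₄, fun X => Prod.ext (hl X) (hl' X)⟩

theorem repr_shape (hM : Nat.card M = p ^ m) {n : M × M →ₗ[ZMod p] M} {x y : M}
    (h : ∀ X, n X = x * frob p m t X.1 + y * frob p m t X.2) :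
    (coordBasis hM).repr n = Finsupp.single (.inl t) x + Finsupp.single (.inr t) y := by
  have : n = x • coordBasis hM (.inl t) + y • coordBasis hM (.inr t) := by
    refine LinearMap.ext fun X => ?_
    simp [h X]
  rw [this]
  simp only [map_add, map_smul, Module.Basis.repr_self, Finsupp.smul_single, smul_eq_mul, mul_one]

theorem shift_eq_of_shape (hM : Nat.card M = p ^ m) {s : ZMod m} (hρ : ρ ≠ 0) (h2 : 2 * ρ ≠ 0)
    {n : M × M →ₗ[ZMod p] M} {x y : M} (hn : n ≠ 0)
    (h : ∀ X, n X = x * frob p m t X.1 + y * frob p m t X.2)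
    (h1 : n ∈ coordSupported hM (pairIndices s ρ))
    (h1' : frobLin p m ρ ∘ₗ n ∈ coordSupported hM (pairIndices s ρ)) : s = t := by
  obtain ⟨x', y', h'⟩ := eq_of_mem_of_frob_mem hρ h2 h1 h1'
  by_contra hst
  have e := (repr_shape hM h').symm.trans (repr_shape hM h)
  have e1 := DFunLike.congr_fun e (.inl t)
  have e2 := DFunLike.congr_fun e (.inr t)
  simp [hst] at e1 e2
  exact hn (LinearMap.ext fun X => by simp [h X, ← e1, ← e2])

end Shape

/-! ### Equations between the matrix entries -/

section Coefficients

variable {p m : ℕ} [Fact p.Prime] {M : Type*} [Field M] [Finite M] [ExpChar M p] [NeZero m]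
  {κ ρ t : ZMod m} {B B' c c' α β l₁ l₂ l₃ l₄ k₁ k₂ k₃ k₄ : M} {L K : M × M → M × M}

theorem fst_coefficients (hM : Nat.card M = p ^ m) (hκ : κ ≠ 0)
    (hL : ∀ X, L X = (l₁ * frob p m t X.1 + l₂ * frob p m t X.2,
      l₃ * frob p m t X.1 + l₄ * frob p m t X.2))
    (hK : ∀ X, K X = (k₁ * frob p m t X.1 + k₂ * frob p m t X.2,
      k₃ * frob p m t X.1 + k₄ * frob p m t X.2))
    (h : ∀ X Y, α * frob p m t (mulFst p κ B X Y) = mulFst p κ B' (L X) (K Y)) :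
    ((frob p m κ l₁ * k₁ + B' * (frob p m κ l₃ * k₃) = α ∧
        l₁ * frob p m κ k₁ + B' * (l₃ * frob p m κ k₃) = α) ∧
      (frob p m κ l₂ * k₂ + B' * (frob p m κ l₄ * k₄) = α * frob p m t B ∧
        l₂ * frob p m κ k₂ + B' * (l₄ * frob p m κ k₄) = α * frob p m t B)) ∧
    ((frob p m κ l₁ * k₂ + B' * (frob p m κ l₃ * k₄) = 0 ∧
        l₁ * frob p m κ k₂ + B' * (l₃ * frob p m κ k₄) = 0) ∧
      (frob p m κ l₂ * k₁ + B' * (frob p m κ l₄ * k₃) = 0 ∧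
        l₂ * frob p m κ k₁ + B' * (l₄ * frob p m κ k₃) = 0)) := by
  refine ⟨⟨?_, ?_⟩, ?_, ?_⟩
  · refine (eq_zero_of_forall_monomials hM hκ fun x y => ?_).imp sub_eq_zero.1 sub_eq_zero.1
    -- Substituting the inverse twist -t leaves the plain monomials in x and y.
    have := h (frob p m (-t) x, 0) (frob p m (-t) y, 0)
    simp [mulFst, hL, hK, frob_frob hM, frob_zero] at this
    linear_combination -this
  · refine (eq_zero_of_forall_monomials hM hκ fun x y => ?_).imp sub_eq_zero.1 sub_eq_zero.1
    have := h (0, frob p m (-t) x) (0, frob p m (-t) y)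
    simp [mulFst, hL, hK, frob_frob hM, frob_zero] at this
    linear_combination -this
  · refine eq_zero_of_forall_monomials hM hκ fun x y => ?_
    have := h (frob p m (-t) x, 0) (0, frob p m (-t) y)
    simp [mulFst, hL, hK, frob_frob hM, frob_zero] at this
    linear_combination -this
  · refine eq_zero_of_forall_monomials hM hκ fun x y => ?_
    have := h (0, frob p m (-t) x) (frob p m (-t) y, 0)
    simp [mulFst, hL, hK, frob_frob hM, frob_zero] at this
    linear_combination -this

theorem snd_coefficients (hM : Nat.card M = p ^ m) (hρ : ρ ≠ 0)
    (hL : ∀ X, L X = (l₁ * frob p m t X.1 + l₂ * frob p m t X.2,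
      l₃ * frob p m t X.1 + l₄ * frob p m t X.2))
    (hK : ∀ X, K X = (k₁ * frob p m t X.1 + k₂ * frob p m t X.2,
      k₃ * frob p m t X.1 + k₄ * frob p m t X.2))
    (h : ∀ X Y, β * frob p m t (mulSnd p ρ c X Y) = mulSnd p ρ c' (L X) (K Y)) :
    ((frob p m ρ l₁ * k₃ + c' * (frob p m ρ l₃ * k₁) = 0 ∧
        l₃ * frob p m ρ k₁ + c' * (l₁ * frob p m ρ k₃) = 0) ∧
      (frob p m ρ l₂ * k₄ + c' * (frob p m ρ l₄ * k₂) = 0 ∧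
        l₄ * frob p m ρ k₂ + c' * (l₂ * frob p m ρ k₄) = 0)) ∧
    ((frob p m ρ l₁ * k₄ + c' * (frob p m ρ l₃ * k₂) = β ∧
        l₃ * frob p m ρ k₂ + c' * (l₁ * frob p m ρ k₄) = β * frob p m t c) ∧
      (frob p m ρ l₂ * k₃ + c' * (frob p m ρ l₄ * k₁) = β * frob p m t c ∧
        l₄ * frob p m ρ k₁ + c' * (l₂ * frob p m ρ k₃) = β)) := by
  refine ⟨⟨?_, ?_⟩, ?_, ?_⟩
  · refine eq_zero_of_forall_monomials hM hρ fun x y => ?_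
    have := h (frob p m (-t) x, 0) (frob p m (-t) y, 0)
    simp [mulSnd, hL, hK, frob_frob hM, frob_zero] at this
    linear_combination -this
  · refine eq_zero_of_forall_monomials hM hρ fun x y => ?_
    have := h (0, frob p m (-t) x) (0, frob p m (-t) y)
    simp [mulSnd, hL, hK, frob_frob hM, frob_zero] at this
    linear_combination -this
  · refine (eq_zero_of_forall_monomials hM hρ fun x y => ?_).imp sub_eq_zero.1 sub_eq_zero.1
    have := h (frob p m (-t) x, 0) (0, frob p m (-t) y)
    simp [mulSnd, hL, hK, frob_frob hM, frob_zero] at this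
    linear_combination -this
  · refine (eq_zero_of_forall_monomials hM hρ fun x y => ?_).imp sub_eq_zero.1 sub_eq_zero.1
    have := h (0, frob p m (-t) x) (frob p m (-t) y, 0)
    simp [mulSnd, hL, hK, frob_frob hM, frob_zero] at this
    linear_combination -this

/-- A column of the matrix of an isotopism has a vanishing entry. -/
theorem column_eq_zero_or {F : Type*} [Field F] {φ ψ : F →+* F} (hφψ : ∀ x, ψ (ψ x) = φ (φ x))
    {b c : F} (hne : b * c * ψ c ≠ φ b) {x z u₁ u₃ v₂ v₄ : F}
    (hu : u₁ ≠ 0 ∨ u₃ ≠ 0) (hv : v₂ ≠ 0 ∨ v₄ ≠ 0)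
    (g₁ : ψ x * u₃ + c * (ψ z * u₁) = 0) (g₂ : z * ψ u₁ + c * (x * ψ u₃) = 0)
    (f₁ : φ x * v₂ + b * (φ z * v₄) = 0) (f₂ : x * φ v₂ + b * (z * φ v₄) = 0) :
    x = 0 ∨ z = 0 := by
  by_contra! hxz
  obtain ⟨hx, hz⟩ := hxz
  have hψx : ψ x ≠ 0 := (map_ne_zero _).2 hx
  have hφx : φ x ≠ 0 := (map_ne_zero _).2 hx
  have hu1 : u₁ ≠ 0 := by
    rintro rfl
    simp [hψx] at g₁
    simp [g₁] at hu
  have hv4 : v₄ ≠ 0 := by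
    rintro rfl
    simp [hφx] at f₁
    simp [f₁] at hv
  have hψu : ψ u₁ ≠ 0 := (map_ne_zero _).2 hu1
  have hφv : φ v₄ ≠ 0 := (map_ne_zero _).2 hv4
  -- With r = z/x, the second component gives r = c ψ(c) ψψ(r) and the first gives φ(b) φφ(r) = b r;
  -- as φφ = ψψ, this contradicts `hne`.
  have e1 : u₃ / u₁ = -c * ψ (z / x) := by
    rw [map_div₀]; field_simp; linear_combination g₁
  have e2 : z / x = -c * ψ (u₃ / u₁) := by
    rw [map_div₀]; field_simp; linear_combination g₂
  have e3 : v₂ / v₄ = -b * φ (z / x) := by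
    rw [map_div₀]; field_simp; linear_combination f₁
  have e4 : φ (v₂ / v₄) = -b * (z / x) := by
    rw [map_div₀]; field_simp; linear_combination f₂
  have hzx : φ (φ (z / x)) ≠ 0 := by simp [hx, hz]
  rw [e1, map_mul, map_neg, hφψ] at e2
  rw [e3, map_mul, map_neg] at e4
  refine hne (mul_right_cancel₀ hzx ?_)
  linear_combination e4 - b * e2

end Coefficients

/-! ### From isotopisms to relations between the parameters -/

section WeakLink

variable {p m : ℕ} [Fact p.Prime] {M : Type*} [Field M] [Algebra (ZMod p) M] [Finite M]
  [ExpChar M p] [NeZero m]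

/-- The relation between the parameters that makes `(x, y) ↦ (x ^ p ^ t, w y ^ p ^ t)` a strong
isotopism, up to the middle nucleus element `s`. -/
def WeakLink (p : ℕ) {m : ℕ} {M : Type*} [Field M] [ExpChar M p] (κ η t : ZMod m)
    (B a B' a' : M) : Prop :=
  ∃ s w : M, s ≠ 0 ∧ w ≠ 0 ∧ frob p m κ s = s ∧
    frob p m t B * s = B' * (frob p m κ w * w) * frob p m η s ∧
    frob p m t a = a' * frob p m κ (frob p m η w * w)

theorem weakLink_of_isotopism (hM : Nat.card M = p ^ m) {κ η t : ZMod m} (hS : ShiftFacts κ η)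
    {B B' a a' α β : M} (hB : B ≠ 0) (hB' : B' ≠ 0) (ha' : a' ≠ 0) (hα : α ≠ 0) (hβ : β ≠ 0)
    (hne : B' * (a' / B') * frob p m (κ + η) (a' / B') ≠ frob p m κ B')
    {L K : (M × M) ≃ₗ[ZMod p] (M × M)}
    (h₁ : ∀ X Y, α * frob p m t (mulFst p κ B X Y) = mulFst p κ B' (L X) (K Y))
    (h₂ : ∀ X Y, β * frob p m t (mulSnd p (κ + η) (a / B) X Y) =
      mulSnd p (κ + η) (a' / B') (L X) (K Y)) :
    WeakLink p κ η t B a B' a' ∨ WeakLink p κ η t B a B'⁻¹ a'⁻¹ := by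
  have hρ : κ + η ≠ 0 := fun h => hS.ne_eta (by linear_combination h - hS.eta_add)
  have hc : a' / B' ≠ 0 := div_ne_zero ha' hB'
  have hφψ : ∀ x : M, frob p m (κ + η) (frob p m (κ + η) x) = frob p m κ (frob p m κ x) :=
    fun x => by
      rw [frob_frob hM, frob_frob hM]
      congr 2
      linear_combination hS.eta_add
  obtain ⟨l₁, l₂, l₃, l₄, hL⟩ := exists_shape_of_fst_eq hM hS.kappa_ne hS.two_ne hB' h₁
  obtain ⟨k₁, k₂, k₃, k₄, hK⟩ := exists_shape_of_fst_eq (L := K) (K := L) hM hS.kappa_ne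
    hS.two_ne hB' fun X Y => by rw [mulFst_comm, h₁, mulFst_comm]
  obtain ⟨⟨⟨f1, f2⟩, f3, f4⟩, ⟨f5, f6⟩, f7, f8⟩ := fst_coefficients hM hS.kappa_ne hL hK h₁
  obtain ⟨⟨⟨g1, g2⟩, g3, g4⟩, ⟨g5, g6⟩, g7, g8⟩ := snd_coefficients hM hρ hL hK h₂
  have col : ∀ {k₁ k₂ k₃ k₄ : M} (K : (M × M) ≃ₗ[ZMod p] (M × M)),
      (∀ X, K X = (k₁ * frob p m t X.1 + k₂ * frob p m t X.2,
        k₃ * frob p m t X.1 + k₄ * frob p m t X.2)) →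
      (k₁ ≠ 0 ∨ k₃ ≠ 0) ∧ (k₂ ≠ 0 ∨ k₄ ≠ 0) ∧ (k₁ ≠ 0 ∨ k₂ ≠ 0) ∧ (k₃ ≠ 0 ∨ k₄ ≠ 0) := by
    intro k₁ k₂ k₃ k₄ K hK
    refine ⟨?_, ?_, ?_, ?_⟩
    · by_contra! h0
      have := K.map_eq_zero_iff (x := (1, 0))
      simp [hK, h0] at this
    · by_contra! h0
      have := K.map_eq_zero_iff (x := (0, 1))
      simp [hK, h0] at this
    · by_contra! h0
      obtain ⟨X, hX⟩ := K.surjective (1, 0)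
      simp [hK, h0] at hX
    · by_contra! h0
      obtain ⟨X, hX⟩ := K.surjective (0, 1)
      simp [hK, h0] at hX
  obtain ⟨cK1, cK2, -, -⟩ := col K hK
  obtain ⟨cL1, cL2, rL1, rL2⟩ := col L hL
  have z1 := column_eq_zero_or hφψ hne cK1 cK2 g1 g2 f5 f6
  have z2 := column_eq_zero_or hφψ hne cK2 cK1 g3 g4 f7 f8
  have hfη : ∀ s : M, frob p m κ s = s → frob p m (κ + η) s = frob p m η s := fun s hs => by
    rw [add_comm, ← frob_frob hM, hs]
  have hta : frob p m t (a / B) * frob p m t B = frob p m t a := by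
    rw [← map_mul, div_mul_cancel₀ _ hB]
  have hfn : ∀ {x : M} (d : ZMod m), x ≠ 0 → frob p m d x ≠ 0 := fun d hx => frob_eq_zero.not.2 hx
  have hψ : ∀ w : M, frob p m κ (frob p m η w * w) = frob p m (κ + η) w * frob p m κ w :=
    fun w => by rw [map_mul, frob_frob hM]
  have hca : a' / B' * B' = a' := div_mul_cancel₀ _ hB'
  rcases z1 with rfl | rfl
  · right
    have h3 : l₃ ≠ 0 := by simpa using cL1
    have h2 : l₂ ≠ 0 := by simpa using rL1
    obtain rfl : l₄ = 0 := z2.resolve_left h2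
    simp only [map_zero, zero_mul, mul_zero, zero_add, add_zero] at f1 f2 f3 f4 g5 g6 g7 g8
    have hk3 : k₃ ≠ 0 := by
      rintro rfl
      exact hα (by rw [← f1]; ring)
    have hk2 : k₂ ≠ 0 := by
      rintro rfl
      exact hβ (by rw [← g5]; ring)
    have hφ3 := hfn κ h3
    have hψ3 := hfn (κ + η) h3
    -- The two monomials of one product have equal coefficients in the source; hence the ratio of K
    -- to L is fixed by κ, and the ratios in the two coordinates are conjugate under η.
    have hs : frob p m κ (k₃ / l₃) = k₃ / l₃ := by
      rw [map_div₀, div_eq_div_iff hφ3 h3]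
      refine mul_left_cancel₀ hB' ?_
      linear_combination f2 - f1
    have hs' : frob p m η (k₃ / l₃) = k₂ / l₂ := by
      rw [← hfη _ hs, map_div₀, div_eq_div_iff hψ3 h2]
      refine mul_left_cancel₀ hc ?_
      linear_combination g8 - g5
    refine ⟨k₃ / l₃, l₂ / l₃, div_ne_zero hk3 h3, div_ne_zero h2 h3, hs, ?_, ?_⟩
    · rw [hs', map_div₀]
      field_simp
      refine mul_left_cancel₀ hα ?_
      linear_combination frob p m κ l₂ * k₂ * f1 - B' * frob p m κ l₃ * k₃ * f3
    · rw [hψ, map_div₀, map_div₀, ← hta]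
      field_simp
      refine mul_left_cancel₀ (mul_ne_zero hα hβ) ?_
      linear_combination -(β * frob p m t (a / B) * frob p m (κ + η) l₃ * frob p m κ l₃ * a') * f3 -
        frob p m κ l₂ * k₂ * frob p m (κ + η) l₃ * frob p m κ l₃ * a' * g7 -
        frob p m κ l₂ * k₂ * frob p m (κ + η) l₂ * k₃ * frob p m (κ + η) l₃ * frob p m κ l₃ * hca +
        frob p m (κ + η) l₂ * frob p m κ l₂ * ((a' / B') * frob p m (κ + η) l₃ * k₂ * f1 + α * g5)
  · left
    have h1 : l₁ ≠ 0 := by simpa using cL1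
    have h4 : l₄ ≠ 0 := by simpa using rL2
    obtain rfl : l₂ = 0 := z2.resolve_right h4
    simp only [map_zero, zero_mul, mul_zero, zero_add, add_zero] at f1 f2 f3 f4 g5 g6 g7 g8
    have hk1 : k₁ ≠ 0 := by
      rintro rfl
      exact hα (by rw [← f1]; ring)
    have hk4 : k₄ ≠ 0 := by
      rintro rfl
      exact hβ (by rw [← g5]; ring)
    have hφ1 := hfn κ h1
    have hψ1 := hfn (κ + η) h1
    have hs : frob p m κ (k₁ / l₁) = k₁ / l₁ := by
      rw [map_div₀, div_eq_div_iff hφ1 h1]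
      linear_combination f2 - f1
    have hs' : frob p m η (k₁ / l₁) = k₄ / l₄ := by
      rw [← hfη _ hs, map_div₀, div_eq_div_iff hψ1 h4]
      linear_combination g8 - g5
    refine ⟨k₁ / l₁, l₄ / l₁, div_ne_zero hk1 h1, div_ne_zero h4 h1, hs, ?_, ?_⟩
    · rw [hs', map_div₀]
      field_simp
      refine mul_left_cancel₀ hα ?_
      linear_combination α * frob p m t B * f1 - α * f3
    · rw [hψ, map_div₀, map_div₀, ← hta]
      field_simp
      refine mul_left_cancel₀ (mul_ne_zero hα hβ) ?_
      linear_combination -(β * frob p m t (a / B) * frob p m (κ + η) l₁ * frob p m κ l₁) * f3 -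
        B' * frob p m κ l₄ * k₄ * frob p m (κ + η) l₁ * frob p m κ l₁ * g7 +
        (a' / B') * B' * frob p m (κ + η) l₄ * frob p m κ l₄ * (frob p m (κ + η) l₁ * k₄ * f1 + α * g5) +
        α * β * frob p m (κ + η) l₄ * frob p m κ l₄ * hca

end WeakLink

/-! ### Relations between the parameters of strong isotopisms -/

section Link

variable {p m : ℕ} [Fact p.Prime] {M : Type*} [Field M] [Finite M] [CharP M p] [ExpChar M p]
  [NeZero m]

/-- The relation between the parameters that makes `(x, y) ↦ (x ^ p ^ t, w y ^ p ^ t)` a strong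
isotopism. -/
def Link (p : ℕ) {m : ℕ} {M : Type*} [Field M] [ExpChar M p] (κ η t : ZMod m)
    (B a B' a' : M) : Prop :=
  ∃ w : M, w ≠ 0 ∧ frob p m t B = B' * (frob p m κ w * w) ∧
    frob p m t a = a' * frob p m κ (frob p m η w * w)

-- If n is odd and nk ≡ 0 mod m, then q^n acts as the identity on M, and q + 1 divides q^n + 1 with
-- an odd quotient 2i + 1. So e^((2i+1)(q+1)) = e².
omit [CharP M p] in
theorem exists_odd_exponent (hp : p ≠ 2) (hM : Nat.card M = p ^ m) {k : ℕ}
    (hk : OddOrder (k : ZMod m)) :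
    ∃ i : ℕ, ∀ e : M, frob p m k (e ^ (2 * i + 1)) * e ^ (2 * i + 1) = e ^ 2 := by
  obtain ⟨n, ⟨l, rfl⟩, hn⟩ := hk
  obtain ⟨j, hj⟩ := exists_half (p := p) hp k
  -- The modulus carries a factor 2, available because q - 1 is even, to make the quotient odd.
  have h1 : (p ^ k) ^ (2 * l + 1) ≡ p ^ k [MOD 2 * (p ^ k + 1)] := by
    have h : (p ^ k) ^ 2 ≡ 1 [MOD 2 * (p ^ k + 1)] := by
      rw [Nat.ModEq.comm, Nat.modEq_iff_dvd' (Nat.one_le_iff_ne_zero.2 (by rw [hj]; positivity))]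
      refine ⟨j, ?_⟩
      rw [hj, Nat.sub_eq_iff_eq_add (by nlinarith)]
      ring
    have := (h.pow l).mul_right (p ^ k)
    rwa [one_pow, one_mul, ← pow_mul, ← pow_succ] at this
  have hle : p ^ k ≤ (p ^ k) ^ (2 * l + 1) := Nat.le_self_pow (by omega) _
  obtain ⟨i, hi⟩ := (Nat.modEq_iff_dvd' hle).1 h1.symm
  have h2 : (2 * i + 1) * p ^ k + (2 * i + 1) = p ^ (k * (2 * l + 1)) + 1 := by
    rw [pow_mul, ← Nat.sub_add_cancel hle, hi]
    ring
  refine ⟨i, fun e => ?_⟩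
  rw [← pow_eq_frob hM, ← pow_mul, ← pow_add, h2, pow_succ, pow_eq_frob hM, Nat.cast_mul, mul_comm,
    ← nsmul_eq_mul', hn, frob_zero, sq]

omit [Fact p.Prime] [CharP M p] in
theorem isSquare_of_frob (hM : Nat.card M = p ^ m) {t : ZMod m} {x : M}
    (h : IsSquare (frob p m t x)) : IsSquare x := by
  have := h.map (frob p m (-t))
  rwa [frob_frob hM, neg_add_cancel, frob_zero] at this

omit [ExpChar M p] [NeZero m] in
theorem isSquare_mul_of_not_isSquare (hp : p ≠ 2) (hM : Nat.card M = p ^ m) (hm : Even m) {x y : M}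
    (hx : ¬IsSquare x) (hy : ¬IsSquare y) : IsSquare (x * y) := by
  have hx0 : x ≠ 0 := fun h => hx (h ▸ IsSquare.zero)
  have hy0 : y ≠ 0 := fun h => hy (h ▸ IsSquare.zero)
  obtain ⟨j, hj⟩ := exists_half (p := p) hp (m / 2)
  by_contra hxy
  have h1 := (pow_card_half hp hM hm hj (mul_ne_zero hx0 hy0)).2 hxy
  rw [mul_pow, (pow_card_half hp hM hm hj hx0).2 hx, (pow_card_half hp hM hm hj hy0).2 hy] at h1
  have : Fact (2 < p) := ⟨lt_of_le_of_ne (Fact.out : p.Prime).two_le hp.symm⟩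
  exact CharP.neg_one_ne_one M p (by rw [← h1]; ring)

-- The quotient of d^Q by d (Q standing for η) has norm 1, and so has its power that solves the
-- first equation. Multiplying w by `v` thus changes w^(q+1) but not the norm of w.
omit [CharP M p] in
theorem exists_twist (hp : p ≠ 2) (hM : Nat.card M = p ^ m) {k : ℕ} (hk : OddOrder (k : ZMod m))
    {η : ZMod m} (hη : η + η = 0) {d : M} (hd : d ≠ 0) :
    ∃ v : M, v ≠ 0 ∧ frob p m k v * v = (frob p m η d / d) ^ 2 ∧ frob p m η v * v = 1 := by
  obtain ⟨i, hi⟩ := exists_odd_exponent (M := M) hp hM hk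
  have hd' : frob p m η d ≠ 0 := frob_eq_zero.not.2 hd
  refine ⟨(frob p m η d / d) ^ (2 * i + 1), pow_ne_zero _ (div_ne_zero hd' hd), hi _, ?_⟩
  rw [map_pow, ← mul_pow, map_div₀, frob_frob hM, hη, frob_zero]
  field_simp
  simp

theorem WeakLink.exists_link (hp : p ≠ 2) (hM : Nat.card M = p ^ m) (hm : Even m) {k : ℕ}
    (hk : OddOrder (k : ZMod m)) {η t : ZMod m} (hη : η + η = 0) {B a B' a' : M} (hB : ¬IsSquare B)
    (ha : frob p m η a = a) (h : WeakLink p (k : ZMod m) η t B a B' a') :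
    ∃ t', Link p (k : ZMod m) η t' B a B' a' := by
  obtain ⟨s, w, hs, hw, hsk, h1, h2⟩ := h
  have hfn : ∀ {x : M} (d : ZMod m), x ≠ 0 → frob p m d x ≠ 0 := fun d hx => frob_eq_zero.not.2 hx
  by_cases hsq : IsSquare s
  · obtain ⟨d, rfl⟩ := hsq
    have hd : d ≠ 0 := left_ne_zero_of_mul hs
    obtain ⟨v, hv, hv1, hv2⟩ := exists_twist hp hM hk hη hd
    refine ⟨t, w * v, mul_ne_zero hw hv, ?_, ?_⟩
    · rw [map_mul, mul_mul_mul_comm, hv1]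
      rw [map_mul] at h1
      field_simp
      linear_combination h1
    · rw [h2, map_mul (frob p m η), mul_mul_mul_comm, hv2, mul_one]
  -- For a non-square s, the product of s with the conjugate of B is a square d²; passing from t to
  -- η + t conjugates it, and the twist by d makes up for that.
  · obtain ⟨d, hd⟩ := isSquare_mul_of_not_isSquare hp hM hm
      (fun h => hB (isSquare_of_frob hM (t := t) h)) hsq
    have hB0 : B ≠ 0 := fun h => hB (h ▸ IsSquare.zero)
    have hd0 : d ≠ 0 := left_ne_zero_of_mul (hd ▸ mul_ne_zero (hfn t hB0) hs)
    obtain ⟨v, hv, hv1, hv2⟩ := exists_twist hp hM hk hη hd0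
    refine ⟨η + t, w * v, mul_ne_zero hw hv, ?_, ?_⟩
    · have hd' := congrArg (frob p m η) hd
      simp only [map_mul] at hd'
      rw [map_mul, mul_mul_mul_comm, hv1, ← frob_frob hM]
      refine mul_right_cancel₀ (hfn η hs) ?_
      field_simp
      linear_combination d ^ 2 * hd' + frob p m η d ^ 2 * (h1 - hd)
    · rw [add_comm, ← frob_frob hM, ha, h2, map_mul (frob p m η), mul_mul_mul_comm, hv2, mul_one]

/-- Write Q = 2j + 1 and let b be the conjugate of B. Then b^Q = b (b^j)², while b^j has norm -1
because b is a non-square. An odd power of b^j therefore absorbs the passage from t to η + t and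
reverses the sign of a'. -/
theorem Link.exists_neg (hp : p ≠ 2) (hM : Nat.card M = p ^ m) (hm : Even m) {k : ℕ}
    (hk : OddOrder (k : ZMod m)) {t : ZMod m} {B a B' a' : M} (hB : ¬IsSquare B)
    (ha : frob p m ((m / 2 : ℕ) : ZMod m) a = a)
    (h : Link p (k : ZMod m) ((m / 2 : ℕ) : ZMod m) t B a B' a') :
    ∃ t', Link p (k : ZMod m) ((m / 2 : ℕ) : ZMod m) t' B a B' (-a') := by
  obtain ⟨w, hw, h1, h2⟩ := h
  set η := ((m / 2 : ℕ) : ZMod m) with hη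
  set b := frob p m t B with hb
  have hb' : ¬IsSquare b := fun h => hB (isSquare_of_frob hM h)
  have hb0 : b ≠ 0 := fun h => hb' (h ▸ IsSquare.zero)
  obtain ⟨i, hi⟩ := exists_odd_exponent (M := M) hp hM hk
  obtain ⟨j, hj⟩ := exists_half (p := p) hp (m / 2)
  have he : frob p m η (b ^ j) * b ^ j = -1 := by
    rw [hη, ← pow_eq_frob hM, ← (pow_card_half hp hM hm hj hb0).2 hb']
    ring
  have he2 : b * (b ^ j) ^ 2 = frob p m η b := by
    rw [hη, ← pow_eq_frob hM, hj]
    ring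
  have hv : frob p m η ((b ^ j) ^ (2 * i + 1)) * (b ^ j) ^ (2 * i + 1) = -1 := by
    rw [map_pow, ← mul_pow, he, Odd.neg_one_pow ⟨i, rfl⟩]
  refine ⟨η + t, w * (b ^ j) ^ (2 * i + 1), mul_ne_zero hw (pow_ne_zero _ (pow_ne_zero _ hb0)),
    ?_, ?_⟩
  · rw [map_mul, mul_mul_mul_comm, hi, ← frob_frob hM, ← hb, ← he2, h1]
    ring
  · rw [add_comm, ← frob_frob hM, ha, h2, map_mul (frob p m η), mul_mul_mul_comm, hv, mul_neg_one,
      map_neg, neg_mul_neg]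

-- The value w^(q+1) is prescribed; its power with exponent 2i + 1 is w², so w is known up to sign
-- and its norm exactly.
omit [CharP M p] in
theorem Link.unique (hp : p ≠ 2) (hM : Nat.card M = p ^ m) {k : ℕ}
    (hk : OddOrder (k : ZMod m)) {η t : ZMod m} {B a B' a₁ a₂ : M} (hB' : B' ≠ 0)
    (h₁ : Link p (k : ZMod m) η t B a B' a₁) (h₂ : Link p (k : ZMod m) η t B a B' a₂) :
    a₁ = a₂ := by
  obtain ⟨w, hw, h1, h2⟩ := h₁
  obtain ⟨w', hw', h1', h2'⟩ := h₂
  have hfn : ∀ {x : M} (d : ZMod m), x ≠ 0 → frob p m d x ≠ 0 := fun d hx => frob_eq_zero.not.2 hx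
  have e : frob p m k w * w = frob p m k w' * w' := mul_left_cancel₀ hB' (h1.symm.trans h1')
  have hsq : w ^ 2 = w' ^ 2 := by
    obtain ⟨i, hi⟩ := exists_odd_exponent (M := M) hp hM hk
    rw [← hi, ← hi, map_pow, ← mul_pow, e, map_pow, mul_pow]
  have e' : frob p m η w * w = frob p m η w' * w' := by
    rcases sq_eq_sq_iff_eq_or_eq_neg.1 hsq with rfl | rfl
    · rfl
    · rw [map_neg, neg_mul_neg]
  rw [h2, e'] at h2'
  exact mul_right_cancel₀ (hfn _ (mul_ne_zero (hfn _ hw') hw')) h2'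

end Link

/-! ### Monomial isotopisms -/

section Equiv

variable {p m : ℕ} [Fact p.Prime] {M : Type*} [Field M] [Algebra (ZMod p) M] [Finite M]
  [ExpChar M p] [NeZero m]

/-- The additive bijection `x ↦ a x ^ p ^ t`. -/
noncomputable def monomialEquiv (p m : ℕ) [Fact p.Prime] {M : Type*} [Field M] [Algebra (ZMod p) M]
    [Finite M] [ExpChar M p] (t : ZMod m) (a : M) (ha : a ≠ 0) : M ≃ₗ[ZMod p] M :=
  LinearEquiv.ofBijective (LinearMap.mulLeft (ZMod p) a ∘ₗ frobLin p m t)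
    (Finite.injective_iff_bijective.1 fun x y h =>
      (frob p m t).injective (mul_left_cancel₀ ha (by simpa using h)))

omit [NeZero m] in
@[simp]
theorem monomialEquiv_apply (t : ZMod m) (a : M) (ha : a ≠ 0) (x : M) :
    monomialEquiv p m t a ha x = a * frob p m t x := rfl

theorem Link.monomiallyIsotopic (hM : Nat.card M = p ^ m) {k : ℕ} {t : ZMod m} {B a B' a' : M}
    (hB' : B' ≠ 0)
    (h : Link p (k : ZMod m) ((m / 2 : ℕ) : ZMod m) t B a B' a') :
    MonomiallyIsotopic p m (familyMul p m k B a) (familyMul p m k B' a') := by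
  obtain ⟨w, hw, h1, h2⟩ := h
  refine ⟨(monomialEquiv p m t 1 one_ne_zero).prodCongr (monomialEquiv p m t w hw),
    (monomialEquiv p m t 1 one_ne_zero).prodCongr (monomialEquiv p m t w hw), ?_, t.val,
    ZMod.val_lt t, ⟨1, w, fun x y => rfl⟩, .inl ⟨1, w, fun x y => rfl⟩⟩
  have hfn : ∀ {x : M} (d : ZMod m), x ≠ 0 → frob p m d x ≠ 0 := fun d hx => frob_eq_zero.not.2 hx
  have hc : w * frob p m t (a / B) = a' / B' * frob p m (k + ((m / 2 : ℕ) : ZMod m)) w := by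
    rw [map_div₀, h1, h2, map_mul, frob_frob hM]
    have := hfn k hw
    field_simp
  intro X Y
  have hsw : ∀ d x, frob p m d (frob p m t x) = frob p m t (frob p m d x) := fun d x => by
    rw [frob_frob hM, frob_frob hM, add_comm]
  rw [familyMul_eq hM, familyMul_eq hM]
  simp only [LinearEquiv.prodCongr_apply, monomialEquiv_apply, mulFst, mulSnd, map_add, map_mul,
    one_mul, hsw]
  ext
  · linear_combination (frob p m t (frob p m k X.2) * frob p m t Y.2 +
      frob p m t X.2 * frob p m t (frob p m k Y.2)) * h1
  · linear_combination (frob p m t X.1 * frob p m t (frob p m (k + ((m / 2 : ℕ) : ZMod m)) Y.2) +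
      frob p m t (frob p m (k + ((m / 2 : ℕ) : ZMod m)) X.2) * frob p m t Y.1) * hc

/-- Exchanging x and y and rescaling both components turns the parameters B', a' into their
inverses. -/
theorem Link.monomiallyIsotopic_swap (hM : Nat.card M = p ^ m) {k : ℕ} {t : ZMod m} {B a B' a' : M}
    (hB' : B' ≠ 0) (ha' : a' ≠ 0)
    (h : Link p (k : ZMod m) ((m / 2 : ℕ) : ZMod m) t B a B'⁻¹ a'⁻¹) :
    MonomiallyIsotopic p m (familyMul p m k B a) (familyMul p m k B' a') := by
  obtain ⟨w, hw, h1, h2⟩ := h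
  refine ⟨(monomialEquiv p m t B' hB').prodCongr
      (monomialEquiv p m t (a' / B' * w) (mul_ne_zero (div_ne_zero ha' hB') hw)),
    (LinearEquiv.prodComm (ZMod p) M M).trans
      ((monomialEquiv p m t w hw).prodCongr (monomialEquiv p m t 1 one_ne_zero)), ?_, t.val,
    ZMod.val_lt t, ⟨B', a' / B' * w, fun x y => rfl⟩, .inr ⟨w, 1, fun x y => rfl⟩⟩
  have hfn : ∀ {x : M} (d : ZMod m), x ≠ 0 → frob p m d x ≠ 0 := fun d hx => frob_eq_zero.not.2 hx
  have hb : B' * frob p m t B = frob p m k w * w := by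
    rw [h1, mul_inv_cancel_left₀ hB']
  have hc : a' / B' * w * frob p m t (a / B) = frob p m (k + ((m / 2 : ℕ) : ZMod m)) w := by
    rw [map_div₀, h1, h2, map_mul, frob_frob hM]
    have := hfn k hw
    field_simp
  intro X Y
  have hsw : ∀ d x, frob p m d (frob p m t x) = frob p m t (frob p m d x) := fun d x => by
    rw [frob_frob hM, frob_frob hM, add_comm]
  rw [familyMul_eq hM, familyMul_eq hM]
  simp only [LinearEquiv.prodCongr_apply, LinearEquiv.trans_apply, LinearEquiv.prodComm_apply,
    Prod.fst_swap, Prod.snd_swap, monomialEquiv_apply, mulFst, mulSnd, map_add, map_mul,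
    one_mul, hsw]
  ext
  · linear_combination (frob p m t (frob p m k X.2) * frob p m t Y.2 +
      frob p m t X.2 * frob p m t (frob p m k Y.2)) * hb
  · linear_combination (frob p m t X.1 * frob p m t (frob p m (k + ((m / 2 : ℕ) : ZMod m)) Y.2) +
      frob p m t (frob p m (k + ((m / 2 : ℕ) : ZMod m)) X.2) * frob p m t Y.1) * hc

end Equiv

/-! ### Formal properties of isotopy -/

section Isotopism

variable {p : ℕ} {V : Type*} [AddCommGroup V] [Module (ZMod p) V] {mul₁ mul₂ mul₃ : V → V → V}

theorem Isotopic.trans (h : Isotopic p mul₁ mul₂) (h' : Isotopic p mul₂ mul₃) :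
    Isotopic p mul₁ mul₃ := by
  obtain ⟨N, L, K, h⟩ := h
  obtain ⟨N', L', K', h'⟩ := h'
  exact ⟨N.trans N', L.trans L', K.trans K', fun X Y => by
    simp only [LinearEquiv.trans_apply, h X Y, h' (L X) (K Y)]⟩

theorem StronglyIsotopic.trans (h : StronglyIsotopic p mul₁ mul₂)
    (h' : StronglyIsotopic p mul₂ mul₃) : StronglyIsotopic p mul₁ mul₃ := by
  obtain ⟨N, L, h⟩ := h
  obtain ⟨N', L', h'⟩ := h'
  exact ⟨N.trans N', L.trans L', fun X Y => by
    simp only [LinearEquiv.trans_apply, h X Y, h' (L X) (L Y)]⟩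

theorem StronglyIsotopic.symm (h : StronglyIsotopic p mul₁ mul₂) :
    StronglyIsotopic p mul₂ mul₁ := by
  obtain ⟨N, L, h⟩ := h
  exact ⟨N.symm, L.symm, fun X Y => by
    rw [LinearEquiv.symm_apply_eq, h, LinearEquiv.apply_symm_apply, LinearEquiv.apply_symm_apply]⟩

theorem StronglyIsotopic.isotopic (h : StronglyIsotopic p mul₁ mul₂) : Isotopic p mul₁ mul₂ := by
  obtain ⟨N, L, h⟩ := h
  exact ⟨N, L, L, h⟩

theorem MonomiallyIsotopic.stronglyIsotopic {m : ℕ} {M : Type*} [Field M] [Algebra (ZMod p) M]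
    {mul₁ mul₂ : M × M → M × M → M × M} (h : MonomiallyIsotopic p m mul₁ mul₂) :
    StronglyIsotopic p mul₁ mul₂ := by
  obtain ⟨N, L, h, -⟩ := h
  exact ⟨N, L, h⟩

end Isotopism

/-! ### Closure properties of the family -/

section Family

variable {p m : ℕ} [Fact p.Prime] {M : Type*} [Field M] [Finite M] [CharP M p] [ExpChar M p]
  [NeZero m] {k k' : ℕ} {B B' a a' : M}

omit [Fact p.Prime] [CharP M p] in
theorem InFamily.frob_half (hM : Nat.card M = p ^ m) (h : InFamily p m k B a) :
    frob p m ((m / 2 : ℕ) : ZMod m) a = a := by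
  rw [← pow_eq_frob hM, h.mem_subfield]

theorem InFamily.nondegenerate' (hp : p ≠ 2) (hM : Nat.card M = p ^ m) (h : InFamily p m k B a) :
    B * (a / B) * frob p m ((k : ZMod m) + ((m / 2 : ℕ) : ZMod m)) (a / B) ≠
      frob p m (k : ZMod m) B := by
  intro e
  refine h.pow_ne hp hM ?_
  have h2 : frob p m ((k : ZMod m) + ((m / 2 : ℕ) : ZMod m)) a = a ^ p ^ k := by
    rw [← frob_frob hM, h.frob_half hM, ← pow_eq_frob hM]
  rw [map_div₀, h2, ← Nat.cast_add, ← pow_eq_frob hM, ← pow_eq_frob hM] at e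
  have hB := h.ne_zero'
  field_simp at e
  rw [mul_add, mul_one, ← pow_add, pow_add, pow_succ]
  rw [← pow_add] at e
  linear_combination -e

omit [Fact p.Prime] [Finite M] [CharP M p] [ExpChar M p] [NeZero m] in
theorem InFamily.mk' (h : InFamily p m k B a) (hB' : ¬IsSquare B') (h0 : a' ≠ 0)
    (ha' : a' ^ p ^ (m / 2) = a') : InFamily p m k B' a' :=
  ⟨h.one_le, h.lt, h.even, h.odd, hB', h0, ha'⟩

omit [Finite M] [CharP M p] [ExpChar M p] [NeZero m] in
theorem InFamily.neg (hp : p ≠ 2) (h : InFamily p m k B a) : InFamily p m k B (-a) :=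
  h.mk' h.nonsquare (neg_ne_zero.2 h.ne_zero)
    (by rw [Odd.neg_pow ((Fact.out : p.Prime).odd_of_ne_two hp).pow, h.mem_subfield])

omit [Fact p.Prime] [CharP M p] in
theorem InFamily.frob_half_norm (hM : Nat.card M = p ^ m) (h : InFamily p m k B a) (x : M) :
    (x ^ (p ^ (m / 2) + 1)) ^ p ^ (m / 2) = x ^ (p ^ (m / 2) + 1) := by
  rw [pow_succ, mul_pow, pow_eq_frob hM, pow_eq_frob hM, frob_frob hM, half_add_half h.even,
    frob_zero, mul_comm]

omit [Fact p.Prime] [CharP M p] in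
theorem InFamily.conj (hM : Nat.card M = p ^ m) (h : InFamily p m k B a) :
    InFamily p m (m - k) B (B ^ (p ^ (m / 2) + 1) / a) := by
  have h1 := h.one_le
  have h2 := h.lt
  refine ⟨by omega, by omega, h.even, ?_, h.nonsquare,
    div_ne_zero (pow_ne_zero _ h.ne_zero') h.ne_zero, ?_⟩
  · have : Nat.gcd (m - k) m = Nat.gcd k m := by
      rw [Nat.gcd_self_sub_left h2.le]
    rw [this]
    exact h.odd
  · rw [div_pow, h.frob_half_norm hM, h.mem_subfield]

end Family

section Arithmetic

theorem three_lt_card {p m : ℕ} [Fact p.Prime] [NeZero m] {M : Type*} (hp : p ≠ 2) (hM : Nat.card M = p ^ m)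
    (hm : Even m) : 3 < Nat.card M := by
  have h2 : 2 ≤ m := by
    obtain ⟨j, rfl⟩ := hm
    have := NeZero.ne (j + j)
    omega
  have h3 : 3 ≤ p := lt_of_le_of_ne (Fact.out : p.Prime).two_le hp.symm
  calc 3 < 3 ^ 2 := by norm_num
    _ ≤ p ^ 2 := Nat.pow_le_pow_left h3 2
    _ ≤ p ^ m := Nat.pow_le_pow_right (by omega) h2
    _ = Nat.card M := hM.symm

theorem eq_or_eq_sub_of_natCast {m k k' : ℕ} (hk : k < m) (hk' : k' < m)
    (h0 : 0 < k) (h : (k' : ZMod m) = k ∨ (k' : ZMod m) = -k) : k' = k ∨ k' = m - k := by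
  rcases h with h | h
  · left
    rw [ZMod.natCast_eq_natCast_iff'] at h
    rwa [Nat.mod_eq_of_lt hk, Nat.mod_eq_of_lt hk'] at h
  · right
    rw [eq_neg_iff_add_eq_zero, ← Nat.cast_add, ZMod.natCast_eq_zero_iff] at h
    obtain ⟨c, hc⟩ := h
    have : c = 1 := by
      have h1 : c < 2 := by
        by_contra! h2
        nlinarith
      interval_cases c <;> omega
    subst this
    omega

end Arithmetic

/-! ### The parts of the classification -/

section Main

variable {p m : ℕ} [Fact p.Prime] {M : Type*} [Field M] [Algebra (ZMod p) M] [Finite M]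
  [CharP M p] [ExpChar M p] [NeZero m] {k k' : ℕ} {B B' a a' : M}

-- Substituting q-th powers turns x^q̄ into x, so the first component is unchanged by symmetry; the
-- second becomes the Q-th power of the old one with its two coefficients exchanged, up to a factor.
omit [CharP M p] in
theorem InFamily.stronglyIsotopic_conj (hM : Nat.card M = p ^ m) (h : InFamily p m k B a) :
    StronglyIsotopic p (familyMul p m k B a)
      (familyMul p m (m - k) B (B ^ (p ^ (m / 2) + 1) / a)) := by
  have hB := h.ne_zero'
  have ha := h.ne_zero
  set η := ((m / 2 : ℕ) : ZMod m) with hη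
  have hη2 : η + η = 0 := half_add_half h.even
  have hBη : frob p m η B ≠ 0 := frob_eq_zero.not.2 hB
  have haη : frob p m η a = a := h.frob_half hM
  refine ⟨(LinearEquiv.refl (ZMod p) M).prodCongr
      (monomialEquiv p m η (frob p m η B / a) (div_ne_zero hBη ha)),
    (monomialEquiv p m (k : ZMod m) 1 one_ne_zero).prodCongr
      (monomialEquiv p m (k : ZMod m) 1 one_ne_zero), fun X Y => ?_⟩
  have hk : ((m - k : ℕ) : ZMod m) = -(k : ZMod m) := by
    rw [Nat.cast_sub h.lt.le, ZMod.natCast_self, zero_sub]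
  rw [familyMul_eq hM, familyMul_eq hM, hk, ← hη, pow_succ, pow_eq_frob hM, ← hη]
  have e1 : -(k : ZMod m) + η + k = η := by ring
  have e2 : η + (k + η) = k := by linear_combination hη2
  ext
  · simp [mulFst, frob_frob hM, frob_zero]
    ring
  · simp [mulSnd, frob_frob hM, e1, e2, haη]
    field_simp
    ring

theorem isotopism_monomial (hp : p ≠ 2) (hM : Nat.card M = p ^ m) (h : InFamily p m k B a)
    {N L K : (M × M) ≃ₗ[ZMod p] (M × M)}
    (hN : IsIsotopism p (familyMul p m k B a) (familyMul p m k' B' a') N L K)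
    (h' : InFamily p m k' B' a') :
    (k' = k ∨ k' = m - k) ∧ ∃ t α s β, α ≠ 0 ∧ β ≠ 0 ∧
      ∀ X, N X = (α * frob p m t X.1, β * frob p m s X.2) := by
  have hK := three_lt_card (M := M) hp hM h.even
  have hc : a / B ≠ 0 := div_ne_zero h.ne_zero h.ne_zero'
  have hN' : ∀ X Y, N (mulFst p (k : ZMod m) B X Y,
      mulSnd p ((k : ZMod m) + ((m / 2 : ℕ) : ZMod m)) (a / B) X Y) =
      (mulFst p (k' : ZMod m) B' (L X) (K Y),
        mulSnd p ((k' : ZMod m) + ((m / 2 : ℕ) : ZMod m)) (a' / B') (L X) (K Y)) := fun X Y => by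
    rw [← familyMul_eq hM, ← familyMul_eq hM, hN X Y]
  have hN1 : PencilRankLEFour hM (k : ZMod m) ((k : ZMod m) + ((m / 2 : ℕ) : ZMod m)) B (a / B)
      (k' : ZMod m)
      (LinearMap.fst _ _ _ ∘ₗ N.toLinearMap) := by
    refine pencilRankLEFour_of _ _ _ _ _ _ _ fun x => ?_
    simpa [hN'] using rankLEFour_fst (k' : ZMod m) B' x L K
  have hN2 : PencilRankLEFour hM (k : ZMod m) ((k : ZMod m) + ((m / 2 : ℕ) : ZMod m)) B (a / B)
      ((k' : ZMod m) + ((m / 2 : ℕ) : ZMod m)) (LinearMap.snd _ _ _ ∘ₗ N.toLinearMap) := by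
    refine pencilRankLEFour_of _ _ _ _ _ _ _ fun x => ?_
    simpa [hN'] using rankLEFour_snd ((k' : ZMod m) + ((m / 2 : ℕ) : ZMod m)) (a' / B') x L K
  have hη := not_oddOrder_half h.even h.pos
  obtain ⟨hk, t, α, hα, h1⟩ := hN1.fst_monomial hK hp h.shiftFacts h.oddOrder hη h'.oddOrder
    h'.natCast_ne_zero h.ne_zero' hc (h.nondegenerate hp hM) (fun h0 => by
      obtain ⟨X, hX⟩ := N.surjective (1, 0)
      have := LinearMap.congr_fun h0 X
      simp [hX] at this)
  obtain ⟨s, β, hβ, h2⟩ := hN2.snd_monomial hK h.shiftFacts h.oddOrder hη h'.oddOrder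
    h'.natCast_ne_zero h.ne_zero' hc (h.nondegenerate hp hM) (fun h0 => by
      obtain ⟨X, hX⟩ := N.surjective (0, 1)
      have := LinearMap.congr_fun h0 X
      simp [hX] at this)
  exact ⟨eq_or_eq_sub_of_natCast h.lt h'.lt h.one_le hk, t, α, s, β, hα, hβ,
    fun X => Prod.ext (h1 X) (h2 X)⟩

theorem exists_link_of_isotopic (hp : p ≠ 2) (hM : Nat.card M = p ^ m) (h : InFamily p m k B a)
    (h' : InFamily p m k B' a')
    (hiso : Isotopic p (familyMul p m k B a) (familyMul p m k B' a')) :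
    ∃ t, Link p (k : ZMod m) ((m / 2 : ℕ) : ZMod m) t B a B' a' ∨
      Link p (k : ZMod m) ((m / 2 : ℕ) : ZMod m) t B a B'⁻¹ a'⁻¹ := by
  obtain ⟨N, L, K, hN⟩ := hiso
  obtain ⟨-, t, α, s, β, hα, hβ, hNf⟩ := isotopism_monomial hp hM h hN h'
  have hS := h.shiftFacts
  set η := ((m / 2 : ℕ) : ZMod m) with hη
  have hρ : (k : ZMod m) + η ≠ 0 := fun h => hS.ne_eta (by linear_combination h - hS.eta_add)
  have hρ2 : 2 * ((k : ZMod m) + η) ≠ 0 :=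
    fun h => hS.two_ne (by linear_combination h - hS.eta_add)
  have hc' : a' / B' ≠ 0 := div_ne_zero h'.ne_zero h'.ne_zero'
  have hN' : ∀ X Y, (α * frob p m t (mulFst p (k : ZMod m) B X Y),
      β * frob p m s (mulSnd p ((k : ZMod m) + η) (a / B) X Y)) =
        (mulFst p (k : ZMod m) B' (L X) (K Y), mulSnd p ((k : ZMod m) + η) (a' / B') (L X) (K Y)) := fun X Y => by
    rw [← familyMul_eq hM, ← hN X Y, hNf, familyMul_eq hM]
  have h1 := fun X Y => congrArg Prod.fst (hN' X Y)
  have h2 := fun X Y => congrArg Prod.snd (hN' X Y)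
  simp only at h1 h2
  obtain ⟨l₁, l₂, l₃, l₄, hL⟩ := exists_shape_of_fst_eq hM hS.kappa_ne hS.two_ne h'.ne_zero' h1
  have hm := mem_of_snd_eq hM hρ hc' h2
  obtain rfl : s = t := shift_eq_of_shape (x := l₁) (y := l₂) hM hρ hρ2 (fun h0 => by
      obtain ⟨X, hX⟩ := L.surjective (1, 0)
      have := LinearMap.congr_fun h0 X
      simp [hX] at this) (fun X => by simp [hL]) hm.1 hm.2
  rcases weakLink_of_isotopism hM hS h.ne_zero' h'.ne_zero' h'.ne_zero hα hβ
    (h'.nondegenerate' hp hM) h1 h2 with hw | hw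
  · obtain ⟨t, ht⟩ := hw.exists_link hp hM h.even h.oddOrder hS.eta_add h.nonsquare (h.frob_half hM)
    exact ⟨t, .inl ht⟩
  · obtain ⟨t, ht⟩ := hw.exists_link hp hM h.even h.oddOrder hS.eta_add h.nonsquare (h.frob_half hM)
    exact ⟨t, .inr ht⟩

theorem monomiallyIsotopic_of_isotopic (hp : p ≠ 2) (hM : Nat.card M = p ^ m)
    (h : InFamily p m k B a) (h' : InFamily p m k B' a')
    (hiso : Isotopic p (familyMul p m k B a) (familyMul p m k B' a')) :
    MonomiallyIsotopic p m (familyMul p m k B a) (familyMul p m k B' a') := by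
  obtain ⟨t, ht | ht⟩ := exists_link_of_isotopic hp hM h h' hiso
  · exact ht.monomiallyIsotopic hM h'.ne_zero'
  · exact ht.monomiallyIsotopic_swap hM h'.ne_zero' h'.ne_zero

theorem monomiallyIsotopic_or (hp : p ≠ 2) (hM : Nat.card M = p ^ m)
    (h : InFamily p m k B a) (h' : InFamily p m k' B' a')
    (hiso : Isotopic p (familyMul p m k B a) (familyMul p m k' B' a')) :
    (k' = k ∧ MonomiallyIsotopic p m (familyMul p m k B a) (familyMul p m k B' a')) ∨
      (k' = m - k ∧ MonomiallyIsotopic p m (familyMul p m k B a)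
        (familyMul p m k B' (B' ^ (p ^ (m / 2) + 1) / a'))) := by
  have hk : k' = k ∨ k' = m - k := by
    obtain ⟨N, L, K, hN⟩ := hiso
    exact (isotopism_monomial hp hM h hN h').1
  rcases hk with rfl | rfl
  · exact .inl ⟨rfl, monomiallyIsotopic_of_isotopic hp hM h h' hiso⟩
  · have hc := h'.conj hM
    have hs := h'.stronglyIsotopic_conj hM
    -- Conjugating the target leads from m - k back to k.
    rw [Nat.sub_sub_self h.lt.le] at hc hs
    exact .inr ⟨rfl, monomiallyIsotopic_of_isotopic hp hM h hc (hiso.trans hs.isotopic)⟩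

theorem stronglyIsotopic_of_isotopic (hp : p ≠ 2) (hM : Nat.card M = p ^ m)
    (h : InFamily p m k B a) (h' : InFamily p m k' B' a')
    (hiso : Isotopic p (familyMul p m k B a) (familyMul p m k' B' a')) :
    StronglyIsotopic p (familyMul p m k B a) (familyMul p m k' B' a') := by
  rcases monomiallyIsotopic_or hp hM h h' hiso with ⟨rfl, hm⟩ | ⟨rfl, hm⟩
  · exact hm.stronglyIsotopic
  · have hs := h'.stronglyIsotopic_conj hM
    rw [Nat.sub_sub_self h.lt.le] at hs
    exact hm.stronglyIsotopic.trans hs.symm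

theorem exists_isotopic_of_not_isSquare (hp : p ≠ 2) (hM : Nat.card M = p ^ m)
    (h : InFamily p m k B a) (hB' : ¬IsSquare B') :
    ∃ a', InFamily p m k B' a' ∧ Isotopic p (familyMul p m k B a) (familyMul p m k B' a') := by
  have hB0 : B' ≠ 0 := fun h => hB' (h ▸ IsSquare.zero)
  obtain ⟨d, hd⟩ := isSquare_mul_of_not_isSquare hp hM h.even h.nonsquare hB'
  obtain ⟨i, hi⟩ := exists_odd_exponent (M := M) hp hM h.oddOrder
  have hd0 : d / B' ≠ 0 :=
    div_ne_zero (left_ne_zero_of_mul (hd ▸ mul_ne_zero h.ne_zero' hB0)) hB0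
  set η := ((m / 2 : ℕ) : ZMod m) with hη
  -- This choice gives w^(q+1) = (d/B')² = B/B'.
  set w := (d / B') ^ (2 * i + 1) with hw
  have hw0 : w ≠ 0 := pow_ne_zero _ hd0
  have hfn : ∀ {x : M} (d : ZMod m), x ≠ 0 → frob p m d x ≠ 0 := fun d hx => frob_eq_zero.not.2 hx
  set n := frob p m k (frob p m η w * w) with hn
  have hn0 : n ≠ 0 := hfn _ (mul_ne_zero (hfn _ hw0) hw0)
  have hn' : frob p m η n = n := by
    rw [hn, frob_frob hM, add_comm, ← frob_frob hM, map_mul (frob p m η), frob_frob hM,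
      half_add_half h.even, frob_zero, mul_comm w]
  have hlink : Link p (k : ZMod m) η 0 B a B' (a / n) := by
    refine ⟨w, hw0, ?_, ?_⟩
    · rw [frob_zero, hw, hi]
      field_simp
      linear_combination hd
    · rw [frob_zero, div_mul_cancel₀ _ hn0]
  refine ⟨a / n, h.mk' hB' (div_ne_zero h.ne_zero hn0) ?_,
    (hlink.monomiallyIsotopic hM hB0).stronglyIsotopic.isotopic⟩
  rw [pow_eq_frob hM, ← hη, map_div₀, hn', h.frob_half hM]

theorem isotopic_neg (hp : p ≠ 2) (hM : Nat.card M = p ^ m)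
    (h : InFamily p m k B a) (h' : InFamily p m k B' a')
    (hiso : Isotopic p (familyMul p m k B a) (familyMul p m k B' a')) :
    Isotopic p (familyMul p m k B a) (familyMul p m k B' (-a')) := by
  obtain ⟨t, ht | ht⟩ := exists_link_of_isotopic hp hM h h' hiso
  · obtain ⟨t', ht'⟩ := ht.exists_neg hp hM h.even h.oddOrder h.nonsquare (h.frob_half hM)
    exact (ht'.monomiallyIsotopic hM h'.ne_zero').stronglyIsotopic.isotopic
  · obtain ⟨t', ht'⟩ := ht.exists_neg hp hM h.even h.oddOrder h.nonsquare (h.frob_half hM)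
    rw [← inv_neg] at ht'
    exact (ht'.monomiallyIsotopic_swap hM h'.ne_zero'
      (neg_ne_zero.2 h'.ne_zero)).stronglyIsotopic.isotopic

theorem ncard_isotopic_le (hp : p ≠ 2) (hM : Nat.card M = p ^ m) (h : InFamily p m k B a) :
    {a' : M | InFamily p m k B' a' ∧
      Isotopic p (familyMul p m k B a) (familyMul p m k B' a')}.ncard ≤ 2 * m := by
  classical
  set S := {a' : M | InFamily p m k B' a' ∧
    Isotopic p (familyMul p m k B a) (familyMul p m k B' a')}
  let P : ZMod m × Bool → M → Prop := fun x a' =>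
    InFamily p m k B' a' ∧ if x.2 then Link p (k : ZMod m) ((m / 2 : ℕ) : ZMod m) x.1 B a B' a'
      else Link p (k : ZMod m) ((m / 2 : ℕ) : ZMod m) x.1 B a B'⁻¹ a'⁻¹
  have hP : ∀ x a₁ a₂, P x a₁ → P x a₂ → a₁ = a₂ := by
    rintro ⟨t, _ | _⟩ a₁ a₂ ⟨g₁, h₁⟩ ⟨g₂, h₂⟩
    · exact inv_injective (Link.unique hp hM h.oddOrder (inv_ne_zero g₁.ne_zero')
        (by simpa using h₁) (by simpa using h₂))
    · exact Link.unique hp hM h.oddOrder g₁.ne_zero' (by simpa using h₁) (by simpa using h₂)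
  let f : ZMod m × Bool → M := fun x => if hx : ∃ a', P x a' then hx.choose else 0
  have hS : S ⊆ f '' Set.univ := by
    rintro a' ⟨h', hiso⟩
    have key : ∀ x, P x a' → a' ∈ f '' Set.univ := by
      intro x hx
      refine ⟨x, trivial, ?_⟩
      have hex : ∃ a', P x a' := ⟨a', hx⟩
      simp only [f, dif_pos hex]
      exact hP x _ _ hex.choose_spec hx
    obtain ⟨t, ht | ht⟩ := exists_link_of_isotopic hp hM h h' hiso
    · exact key (t, true) ⟨h', by simpa using ht⟩
    · exact key (t, false) ⟨h', by simpa using ht⟩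
  calc S.ncard ≤ (f '' Set.univ).ncard := Set.ncard_le_ncard hS
    _ ≤ (Set.univ : Set (ZMod m × Bool)).ncard := Set.ncard_image_le
    _ = 2 * m := by
      rw [Set.ncard_univ, Nat.card_prod, Nat.card_zmod, Nat.card_eq_fintype_card,
        Fintype.card_bool, mul_comm]

end Main

/-- Classification of the isotopisms between members of the family `S`. -/
theorem theorem6p2 (p m : ℕ) [Fact p.Prime] (hp : p ≠ 2)
    {M : Type*} [Field M] [Finite M] [Algebra (ZMod p) M] (hM : Nat.card M = p ^ m) :
    -- (i) isotopy is the same as strong isotopy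
    (∀ (k k' : ℕ) (B B' a a' : M), InFamily p m k B a → InFamily p m k' B' a' →
      (Isotopic p (familyMul p m k B a) (familyMul p m k' B' a') ↔
        StronglyIsotopic p (familyMul p m k B a) (familyMul p m k' B' a'))) ∧
    -- (ii) replacing `q = p ^ k` by `p ^ (m - k)`
    (∀ (k : ℕ) (B a : M), InFamily p m k B a →
      InFamily p m (m - k) B (B ^ (p ^ (m / 2) + 1) / a) ∧
      Isotopic p (familyMul p m k B a)
        (familyMul p m (m - k) B (B ^ (p ^ (m / 2) + 1) / a))) ∧
    -- (iii) replacing `B` by any other non-square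
    (∀ (k : ℕ) (B B' a : M), InFamily p m k B a → ¬ IsSquare B' →
      ∃ a' : M, InFamily p m k B' a' ∧
        Isotopic p (familyMul p m k B a) (familyMul p m k B' a')) ∧
    -- (iv) replacing `a'` by `-a'`
    (∀ (k : ℕ) (B a a' : M), InFamily p m k B a → InFamily p m k B a' →
      Isotopic p (familyMul p m k B a) (familyMul p m k B a') →
      InFamily p m k B (-a') ∧
        Isotopic p (familyMul p m k B a) (familyMul p m k B (-a'))) ∧
    -- (v) at most `2 m` values of `a'`
    (∀ (k : ℕ) (B a : M), InFamily p m k B a →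
      {a' : M | InFamily p m k B a' ∧
        Isotopic p (familyMul p m k B a) (familyMul p m k B a')}.ncard ≤ 2 * m) ∧
    -- (vi) there are no other isotopisms
    (∀ (k k' : ℕ) (B B' a a' : M), InFamily p m k B a → InFamily p m k' B' a' →
      Isotopic p (familyMul p m k B a) (familyMul p m k' B' a') →
      (k' = k ∧ MonomiallyIsotopic p m (familyMul p m k B a) (familyMul p m k B' a')) ∨
      (k' = m - k ∧ MonomiallyIsotopic p m (familyMul p m k B a)
        (familyMul p m k B' (B' ^ (p ^ (m / 2) + 1) / a')))) := by
  have : CharP M p := charP_of_injective_algebraMap (algebraMap (ZMod p) M).injective p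
  have : ExpChar M p := .prime Fact.out
  have hm : NeZero m := by
    refine ⟨?_⟩
    rintro rfl
    have := Finite.one_lt_card (α := M)
    rw [hM, pow_zero] at this
    exact lt_irrefl _ this
  refine ⟨fun k k' B B' a a' h h' => ⟨stronglyIsotopic_of_isotopic hp hM h h',
      StronglyIsotopic.isotopic⟩,
    fun k B a h => ⟨h.conj hM, (h.stronglyIsotopic_conj hM).isotopic⟩,
    fun k B B' a h hB' => exists_isotopic_of_not_isSquare hp hM h hB',
    fun k B a a' h h' hiso => ⟨h'.neg hp, isotopic_neg hp hM h h' hiso⟩,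
    fun k B a h => ncard_isotopic_le hp hM h,
    fun k k' B B' a a' h h' hiso => ?_⟩
  rcases monomiallyIsotopic_or hp hM h h' hiso with ⟨rfl, hm⟩ | hm
  · exact .inl ⟨rfl, hm⟩
  · exact .inr hm
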